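/- Let $f(w;x)\in\mathbb R$, $w\in\mathbb R^Q$, $x\in\mathbb R^p$, be a network that, for every input $x$, is $C^1$ in $w$ with Lipschitz continuous gradient (Assumption A); let $l(y,o)$ be a loss that, for every target $y$, is convex and $C^1$ in $o\in\mathbb R$ with Lipschitz continuous derivative; let $(x_i,y_i)_{i=1}^N$ be a training set, $r:\mathbb R^Q\to\mathbb R$ convex (possibly non-smooth) and $\lambda>0$. Put $l_i(w)=l(y_i,f(w;x_i))$ and consider the problem $$\min_{w}\; U(w)=\frac1N\sum_{i=1}^N l_i(w)+\lambda\, r(w).$$ A point $w$ is called stationary if $0\in\nabla\big(\frac1N\sum_i l_i\big)(w)+\lambda\,\partial r(w)$. Let $\widetilde l_i(\cdot\,;z)$, $z\in\mathbb R^Q$, be surrogates such that (Assumption B) $\widetilde l_i(\cdot\,;z)$ is differentiable and convex, $\nabla\widetilde l_i(z;z)=\nabla l_i(z)$, and $\nabla\widetilde l_i(\cdot\,;z)$ is Lipschitz continuous with a constant $M$ that does not depend on $z$ (or, more generally, that is common to all $z$ in any given bounded set). Let $\tau>0$; or let $\tau=0$, if $r$ is strongly convex. At each time $n=0,1,2,\dots$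 a mini-batch $\mathcal I_n$ of $L\ge 1$ indices in $\{1,\dots,N\}$ is drawn, independently of the past, so that every index has the expected multiplicity $L/N$ (e.g. uniformly, with or without replacement). From arbitrary, possibly random, $w_0,d_0$ that are determined by the past at time $0$, the stochastic SCA algorithm sets $$\widehat w_{n+1}=\arg\min_{w}\Big\{\rho_n\frac1L\sum_{i\in\mathcal I_n}\widetilde l_i(w;w_n)+\lambda r(w)+(1-\rho_n)d_n^T(w-w_n)+\tau\|w-w_n\|^2\Big\},$$ $$w_{n+1}=(1-\alpha_n)w_n+\alpha_n\widehat w_{n+1},\qquad d_{n+1}=(1-\rho_n)d_n+\rho_n\frac1L\sum_{i\in\mathcal I_n}\nabla l_i(w_n).$$ Assume that $\alpha_n\ge 0$, $\rho_n>0$ and (i) $\alpha_n\to0$, $\sum_n\alpha_n=\infty$, $\sum_n\alpha_n^2<\infty$; (ii) $\rho_n\to0$, $\sum_n\rho_n=\infty$, $\sum_n\rho_n^2<\infty$; (iii) $\alpha_n/\rho_n\to0$. Assume also that almost surely the sequence $\{w_n\}$ is bounded. Then, almost surely, $\{w_n\}$ has a limit point, and every limit point of $\{w_n\}$ is a stationary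 point of the above problem and is the limit of a subsequence of $\{w_n\}$. -/

import Mathlib

open MeasureTheory ProbabilityTheory Filter Topology
open scoped NNReal

namespace StochasticSCA

/-- The parameter space `ℝ^Q` with the Euclidean norm. -/
abbrev Weights (Q : ℕ) : Type := EuclideanSpace ℝ (Fin Q)

/-- Assumption on the network `f (w; x)`: for every input `x` it is `C^1` in the weights `w`,
with a (globally) Lipschitz gradient. -/
structure NetworkAssumption {Q p : ℕ}
    (f : Weights Q → EuclideanSpace ℝ (Fin p) → ℝ) : Prop where
  contDiff : ∀ x, ContDiff ℝ 1 (fun w => f w x)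
  lipschitz_gradient : ∀ x, ∃ K : ℝ≥0, LipschitzWith K (gradient (fun w => f w x))

/-- Assumption on the loss `l (y, o)`: for every target `y` it is convex and `C^1` in the network
output `o`, with a Lipschitz derivative. -/
structure LossAssumption (l : ℝ → ℝ → ℝ) : Prop where
  convex : ∀ y, ConvexOn ℝ Set.univ (l y)
  contDiff : ∀ y, ContDiff ℝ 1 (l y)
  lipschitz_deriv : ∀ y, ∃ K : ℝ≥0, LipschitzWith K (deriv (l y))

/-- The `i`-th loss term `l_i (w) = l (y_i, f (w; x_i))`. -/
def sampleLoss {Q p N : ℕ} (l : ℝ → ℝ → ℝ) (f : Weights Q → EuclideanSpace ℝ (Fin p) → ℝ)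
    (x : Fin N → EuclideanSpace ℝ (Fin p)) (y : Fin N → ℝ) (i : Fin N) (w : Weights Q) : ℝ :=
  l (y i) (f w (x i))

/-- The smooth part `(1 / N) ∑ i, l_i (w)` of the training objective. -/
noncomputable def empiricalLoss {Q N : ℕ} (li : Fin N → Weights Q → ℝ) (w : Weights Q) : ℝ :=
  (1 / (N : ℝ)) * ∑ i, li i w

/-- `s` is a subgradient of `r` at `w`. -/
def IsSubgradient {Q : ℕ} (r : Weights Q → ℝ) (w s : Weights Q) : Prop :=
  ∀ u, r w + inner ℝ s (u - w) ≤ r u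

/-- `w` is a stationary point of `min U`, where `U (w) = (1 / N) ∑ i, l_i (w) + lam * r (w)` with
differentiable `l_i` and convex `r`: zero belongs to `∇ ((1 / N) ∑ i, l_i) (w) + lam • ∂r (w)`. -/
def IsStationaryPoint {Q N : ℕ} (li : Fin N → Weights Q → ℝ) (r : Weights Q → ℝ) (lam : ℝ)
    (w : Weights Q) : Prop :=
  ∃ s, IsSubgradient r w s ∧ gradient (empiricalLoss li) w + lam • s = 0

/-- Assumption on the surrogates; `lt i u z` is the value at `u` of the surrogate of `l_i` built at
the current point `z`. The Lipschitz constant of the gradient (in `u`) only has to be common to the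
base points `z` of each ball; a single constant `M` for all `z` is a special case. -/
structure SurrogateAssumption {Q N : ℕ} (li : Fin N → Weights Q → ℝ)
    (lt : Fin N → Weights Q → Weights Q → ℝ) : Prop where
  differentiable : ∀ i z, Differentiable ℝ (fun u => lt i u z)
  convex : ∀ i z, ConvexOn ℝ Set.univ (fun u => lt i u z)
  gradient_eq : ∀ i z, gradient (fun u => lt i u z) z = gradient (li i) z
  lipschitz_gradient : ∀ R : ℝ, ∃ M : ℝ≥0, ∀ i, ∀ z : Weights Q, ‖z‖ ≤ R →
    LipschitzWith M (gradient (fun u => lt i u z))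

/-- The objective, as a function of `u`, of the surrogate problem at the current point `z`, with
auxiliary variable `d`, mixing weight `ρ` and mini-batch `b`. -/
noncomputable def surrogateObjective {Q N L : ℕ} (lt : Fin N → Weights Q → Weights Q → ℝ)
    (r : Weights Q → ℝ) (lam τ ρ : ℝ) (b : Fin L → Fin N) (z d u : Weights Q) : ℝ :=
  ρ * ((1 / (L : ℝ)) * ∑ j, lt (b j) u z) + lam * r u + (1 - ρ) * inner ℝ d (u - z)
    + τ * ‖u - z‖ ^ 2

/-- The random mini-batches `b n` of `L` indices in `Fin N`: `b n` is revealed between the times `n`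
and `n + 1`, it is independent of the past `ℱ n`, and all the indices have the same expected number
`L / N` of occurrences in it. This holds for uniform sampling with replacement as well as for
uniform sampling without replacement. -/
structure IsMiniBatchSampling {Ω : Type*} {mΩ : MeasurableSpace Ω} (μ : Measure Ω)
    (ℱ : Filtration ℕ mΩ) {N L : ℕ} (b : ℕ → Ω → Fin L → Fin N) : Prop where
  measurable : ∀ n, Measurable[ℱ (n + 1)] (b n)
  indep : ∀ n, Indep (MeasurableSpace.comap (b n) inferInstance) (ℱ n) μ
  uniform : ∀ n i, ∑ j, μ.real {ω | b n ω j = i} = (L : ℝ) / N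

/-- `(w, what, d)` is a run of the stochastic SCA algorithm along the mini-batches `b`. The initial
`w 0` and `d 0` are arbitrary (possibly random, known at time `0`), and `w n` is known at
time `n`. -/
structure IsSCARun {Ω : Type*} {mΩ : MeasurableSpace Ω} (ℱ : Filtration ℕ mΩ) {Q N L : ℕ}
    (li : Fin N → Weights Q → ℝ) (lt : Fin N → Weights Q → Weights Q → ℝ)
    (r : Weights Q → ℝ) (lam τ : ℝ) (α ρ : ℕ → ℝ) (b : ℕ → Ω → Fin L → Fin N)
    (w what d : ℕ → Ω → Weights Q) : Prop where
  measurable_w : ∀ n, Measurable[ℱ n] (w n)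
  measurable_d_zero : Measurable[ℱ 0] (d 0)
  what_succ : ∀ n ω,
    IsMinOn (surrogateObjective lt r lam τ (ρ n) (b n ω) (w n ω) (d n ω)) Set.univ
      (what (n + 1) ω)
  w_succ : ∀ n ω, w (n + 1) ω = (1 - α n) • w n ω + α n • what (n + 1) ω
  d_succ : ∀ n ω, d (n + 1) ω =
    (1 - ρ n) • d n ω + ρ n • ((1 / (L : ℝ)) • ∑ j, gradient (li (b n ω j)) (w n ω))

/-- `a` is nonnegative, tends to `0`, is not summable and is square-summable. -/
structure IsDiminishing (a : ℕ → ℝ) : Prop where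
  nonneg : ∀ n, 0 ≤ a n
  tendsto_zero : Tendsto a atTop (𝓝 0)
  sum_eq_top : Tendsto (fun n => ∑ k ∈ Finset.range n, a k) atTop atTop
  summable_sq : Summable (fun n => a n ^ 2)

end StochasticSCA

namespace StochasticSCA

/-! ### Real sequences: perturbed descent, divergent weights, averages. -/

section Sequences

/-! Write G for the gradient of the empirical loss, v_n for the surrogate minimizer computed at time
n, Δ_n = v_n - w_n, and e_n = d_n - G(w_n) for the tracking error. Convexity of the subproblem, made
strong by τ or by r, shows that U decreases by a multiple of α_n‖Δ_n‖², up to α_n‖e_n‖‖Δ_n‖ and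
summable terms (`objective_step_le`). Averaging contracts ‖e_n‖² by the factor 1 - ρ_n/2, up to a
sampling-noise cross term, O(ρ_n²), and a drift of order (α_n²/ρ_n)‖Δ_n‖²
(`norm_sq_averaging_step_le`). Since α_n/ρ_n → 0, adding the two estimates absorbs all the coupling:
U(w_n) + ‖e_n‖² is a Lyapunov function, and Σ α_n‖Δ_n‖² and Σ ρ_n‖e_n‖² are finite once the noise
series converges. It converges almost surely on bounded paths, being a martingale with
square-summable increments after truncation (`ae_tendsto_sum_batch_noise`).

Summability alone gives only a zero lower limit. For e_n, the recursion also makes ‖e_n‖² converge,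
so its limit is 0. For Δ_n, the minimizer v_n depends on w_n in a Lipschitz way up to vanishing
errors, so ‖Δ_n‖ cannot stay large without the path travelling a distance that the finite sum
forbids (`tendsto_zero_of_summable_mul_sq`). With both limits zero
(`tendsto_zero_of_noise_converges`), the optimality condition of the subproblem passes to the limit
along a convergent subsequence and becomes stationarity (`isStationaryPoint_of_mapClusterPt`). -/

theorem sub_sum_le_of_descent {x z : ℕ → ℝ} {n₀ : ℕ}
    (h : ∀ n, n₀ ≤ n → x (n + 1) ≤ x n + z n) {n : ℕ} (hn : n₀ ≤ n) :
    x n - ∑ k ∈ Finset.range n, z k ≤ x n₀ - ∑ k ∈ Finset.range n₀, z k := by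
  induction n, hn using Nat.le_induction with
  | base => exact le_rfl
  | succ n hn ih =>
    rw [Finset.sum_range_succ]
    linarith [h n hn]

/-- A deterministic Robbins–Siegmund argument. The perturbation may change sign and need not be
absolutely summable, which is what the martingale noise requires; only the boundedness of its
partial sums is used. -/
theorem summable_of_descent {x y z : ℕ → ℝ} {B l : ℝ} (hy : ∀ n, 0 ≤ y n) (hx : ∀ n, B ≤ x n)
    (hz : Tendsto (fun n => ∑ k ∈ Finset.range n, z k) atTop (𝓝 l))
    (h : ∀ᶠ n in atTop, x (n + 1) ≤ x n - y n + z n) : Summable y := by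
  obtain ⟨n₀, h⟩ := eventually_atTop.1 h
  obtain ⟨C, hC⟩ := hz.bddAbove_range
  have hC' : ∀ n, ∑ k ∈ Finset.range n, z k ≤ C := fun n => hC ⟨n, rfl⟩
  refine summable_of_sum_range_le (c := x n₀ - ∑ k ∈ Finset.range n₀, (z k - y k) - B + C) hy
    fun n => ?_
  have key := sub_sum_le_of_descent (x := x) (z := fun k => z k - y k) (n₀ := n₀)
    (fun n hn => by linarith [h n hn]) (le_max_right n n₀)
  have hmono : ∑ k ∈ Finset.range n, y k ≤ ∑ k ∈ Finset.range (max n n₀), y k :=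
    Finset.sum_le_sum_of_subset_of_nonneg (Finset.range_mono (le_max_left _ _)) fun _ _ _ => hy _
  rw [Finset.sum_sub_distrib (s := Finset.range (max n n₀))] at key
  linarith [hC' (max n n₀), hx (max n n₀)]

theorem tendsto_of_descent {x z : ℕ → ℝ} {B l : ℝ} (hx : ∀ n, B ≤ x n)
    (hz : Tendsto (fun n => ∑ k ∈ Finset.range n, z k) atTop (𝓝 l))
    (h : ∀ᶠ n in atTop, x (n + 1) ≤ x n + z n) : ∃ a, Tendsto x atTop (𝓝 a) := by
  obtain ⟨n₀, h⟩ := eventually_atTop.1 h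
  obtain ⟨C, hC⟩ := hz.bddAbove_range
  have hC' : ∀ n, ∑ k ∈ Finset.range n, z k ≤ C := fun n => hC ⟨n, rfl⟩
  -- Subtracting the accumulated perturbation turns approximate descent into true monotonicity.
  have hanti : Antitone fun n => x (n + n₀) - ∑ k ∈ Finset.range (n + n₀), z k := by
    refine antitone_nat_of_succ_le fun n => ?_
    have := h (n + n₀) (by omega)
    rw [show n + 1 + n₀ = n + n₀ + 1 by ring, Finset.sum_range_succ]
    linarith
  have hbdd : BddBelow (Set.range fun n => x (n + n₀) - ∑ k ∈ Finset.range (n + n₀), z k) := by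
    refine ⟨B - C, ?_⟩
    rintro _ ⟨n, rfl⟩
    linarith [hx (n + n₀), hC' (n + n₀)]
  have h1 := tendsto_atTop_ciInf hanti hbdd
  have h2 := (tendsto_add_atTop_iff_nat n₀).2 hz
  refine ⟨_, (tendsto_add_atTop_iff_nat n₀).1 ((h1.add h2).congr fun n => ?_)⟩
  ring

theorem not_summable_of_sum_tendsto_atTop {a : ℕ → ℝ}
    (h : Tendsto (fun n => ∑ k ∈ Finset.range n, a k) atTop atTop) : ¬ Summable a :=
  fun hs => not_tendsto_nhds_of_tendsto_atTop h _ hs.hasSum.tendsto_sum_nat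

/-- A weighted sum can only be summable if the terms do not stay away from zero. -/
theorem not_eventually_ge_of_summable_mul {a x : ℕ → ℝ} (ha : ∀ n, 0 ≤ a n)
    (hsum : Tendsto (fun n => ∑ k ∈ Finset.range n, a k) atTop atTop)
    (hs : Summable fun n => a n * x n) {δ : ℝ} (hδ : 0 < δ) : ¬ ∀ᶠ n in atTop, δ ≤ x n := by
  intro h
  refine not_summable_of_sum_tendsto_atTop hsum ?_
  refine Summable.of_norm_bounded_eventually_nat (hs.mul_left δ⁻¹) ?_
  filter_upwards [h] with n hn
  rw [Real.norm_of_nonneg (ha n), inv_mul_eq_div, le_div_iff₀ hδ]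
  exact mul_le_mul_of_nonneg_left hn (ha n)

theorem tendsto_zero_of_summable_mul {a x : ℕ → ℝ} (ha : ∀ n, 0 ≤ a n)
    (hsum : Tendsto (fun n => ∑ k ∈ Finset.range n, a k) atTop atTop) (hx : ∀ n, 0 ≤ x n)
    (hs : Summable fun n => a n * x n) {l : ℝ} (hl : Tendsto x atTop (𝓝 l)) :
    Tendsto x atTop (𝓝 0) := by
  have h0 : 0 ≤ l := ge_of_tendsto' hl hx
  rcases h0.eq_or_lt with rfl | h0
  · exact hl
  · exact absurd (hl.eventually_const_le (show l / 2 < l by linarith))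
      (not_eventually_ge_of_summable_mul ha hsum hs (half_pos h0))

/-- If the increments of `x` are `a n * ‖y n‖` and `‖y n‖` depends on `x n` in a Lipschitz way up to
vanishing errors, then `∑ a n * ‖y n‖ ^ 2 < ∞` and `∑ a n = ∞` force `y n → 0`. -/
theorem tendsto_zero_of_summable_mul_sq {E : Type*} [SeminormedAddCommGroup E] {a t η : ℕ → ℝ}
    {x : ℕ → E} {C : ℝ} (ha : ∀ n, 0 ≤ a n)
    (hsum : Tendsto (fun n => ∑ k ∈ Finset.range n, a k) atTop atTop) (ht : ∀ n, 0 ≤ t n)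
    (hs : Summable fun n => a n * t n ^ 2) (hη : Tendsto η atTop (𝓝 0)) (hC : 0 ≤ C)
    (hx : ∀ n, ‖x (n + 1) - x n‖ ≤ a n * t n)
    (hlip : ∀ m n, t n ≤ t m + C * ‖x m - x n‖ + η n + η m) : Tendsto t atTop (𝓝 0) := by
  by_contra hcon
  -- The factor 3 is a budget: of 3δ, one δ pays for the distance travelled, δ/2 for each of the two
  -- errors η, and δ remains.
  have hfreq : ∃ δ > 0, ∃ᶠ n in atTop, 3 * δ ≤ t n := by
    by_contra! hcon'
    refine hcon (Metric.tendsto_atTop.2 fun ε hε => ?_)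
    have := hcon' (ε / 3) (by positivity)
    obtain ⟨n₀, h⟩ := eventually_atTop.1 this
    refine ⟨n₀, fun n hn => ?_⟩
    have := h n hn
    rw [Real.dist_eq, sub_zero, abs_of_nonneg (ht n)]
    linarith
  obtain ⟨δ, hδ, hfreq⟩ := hfreq
  have htail := tendsto_sum_nat_add fun n => a n * t n ^ 2
  have hev1 : ∀ᶠ n in atTop, C * (∑' k, a (k + n) * t (k + n) ^ 2) / δ < δ := by
    have : Tendsto (fun n => C * (∑' k, a (k + n) * t (k + n) ^ 2) / δ) atTop (𝓝 0) := by
      simpa using (htail.const_mul C).div_const δ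
    exact this.eventually_lt_const hδ
  have hev2 : ∀ᶠ n in atTop, ∀ k, n ≤ k → η k < δ / 2 := by
    obtain ⟨n₀, h⟩ := eventually_atTop.1 (hη.eventually_lt_const (half_pos hδ))
    exact eventually_atTop.2 ⟨n₀, fun n hn k hk => h k (hn.trans hk)⟩
  obtain ⟨n, hn, h1, h2⟩ := (hfreq.and_eventually (hev1.and hev2)).exists
  -- While t has stayed above δ, each step length satisfies a t ≤ a t²/δ, so the path has moved by
  -- at most the tail of the convergent series over δ. This is too little for t to fall below δ at
  -- the next time; hence t never does, contradicting summability.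
  have key : ∀ k, δ ≤ t (k + n) := by
    intro k
    induction k using Nat.strong_induction_on with
    | _ k ih =>
      have hdist : ‖x n - x (k + n)‖ ≤ ∑ j ∈ Finset.range k, a (j + n) * t (j + n) := by
        rw [norm_sub_rev]
        clear ih
        induction k with
        | zero => simp
        | succ k ihk =>
          rw [Finset.sum_range_succ, show k + 1 + n = k + n + 1 by ring]
          calc ‖x (k + n + 1) - x n‖
              ≤ ‖x (k + n + 1) - x (k + n)‖ + ‖x (k + n) - x n‖ := norm_sub_le_norm_sub_add_norm_sub ..
            _ ≤ _ := by linarith [hx (k + n)]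
      have hsq : ∑ j ∈ Finset.range k, a (j + n) * t (j + n) ≤
          (∑' k, a (k + n) * t (k + n) ^ 2) / δ := by
        rw [le_div_iff₀ hδ, Finset.sum_mul]
        have hs' : Summable fun k => a (k + n) * t (k + n) ^ 2 :=
          (summable_nat_add_iff (f := fun n => a n * t n ^ 2) n).2 hs
        refine le_trans (Finset.sum_le_sum fun j hj => ?_)
          (hs'.sum_le_tsum (Finset.range k) fun j _ => mul_nonneg (ha _) (sq_nonneg _))
        rw [mul_assoc, sq]
        exact mul_le_mul_of_nonneg_left
          (mul_le_mul_of_nonneg_left (ih j (Finset.mem_range.1 hj)) (ht _)) (ha _)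
      have h3 : C * ‖x n - x (k + n)‖ ≤ C * (∑' k, a (k + n) * t (k + n) ^ 2) / δ := by
        rw [mul_div_assoc]
        exact mul_le_mul_of_nonneg_left (hdist.trans hsq) hC
      have h4 := hlip (k + n) n
      rw [norm_sub_rev] at h4
      linarith [h2 n le_rfl, h2 (k + n) (by omega)]
  refine not_eventually_ge_of_summable_mul ha hsum hs (pow_pos hδ 2) ?_
  refine eventually_atTop.2 ⟨n, fun k hk => ?_⟩
  have := key (k - n)
  rw [Nat.sub_add_cancel hk] at this
  exact pow_le_pow_left₀ hδ.le this 2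

/-- Eventual averages of bounded vectors stay bounded. -/
theorem exists_norm_le_of_averaging {E : Type*} [SeminormedAddCommGroup E] [NormedSpace ℝ E]
    {ρ : ℕ → ℝ} (hρ : ∀ n, 0 ≤ ρ n) (hρ1 : ∀ᶠ n in atTop, ρ n ≤ 1) {d s : ℕ → E} {B : ℝ}
    (hs : ∀ n, ‖s n‖ ≤ B) (hd : ∀ n, d (n + 1) = (1 - ρ n) • d n + ρ n • s n) :
    ∃ C, ∀ n, ‖d n‖ ≤ C := by
  obtain ⟨n₀, h⟩ := eventually_atTop.1 hρ1
  have hlate : ∀ n, n₀ ≤ n → ‖d n‖ ≤ max ‖d n₀‖ B := by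
    intro n hn
    induction n, hn using Nat.le_induction with
    | base => exact le_max_left _ _
    | succ n hn ih =>
      rw [hd]
      have h1 : 0 ≤ 1 - ρ n := by linarith [h n hn]
      calc ‖(1 - ρ n) • d n + ρ n • s n‖ ≤ ‖(1 - ρ n) • d n‖ + ‖ρ n • s n‖ := norm_add_le _ _
        _ = (1 - ρ n) * ‖d n‖ + ρ n * ‖s n‖ := by
          rw [norm_smul, norm_smul, Real.norm_of_nonneg h1, Real.norm_of_nonneg (hρ n)]
        _ ≤ (1 - ρ n) * max ‖d n₀‖ B + ρ n * max ‖d n₀‖ B := by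
          gcongr
          · exact hρ n
          · exact (hs n).trans (le_max_right _ _)
        _ = max ‖d n₀‖ B := by ring
  refine ⟨max (∑ k ∈ Finset.range n₀, ‖d k‖) (max ‖d n₀‖ B), fun n => ?_⟩
  rcases lt_or_ge n n₀ with hn | hn
  · exact le_max_of_le_left (Finset.single_le_sum (f := fun k => ‖d k‖)
      (fun _ _ => norm_nonneg _) (Finset.mem_range.2 hn))
  · exact le_max_of_le_right (hlate n hn)

theorem norm_average_le {E : Type*} [SeminormedAddCommGroup E] [NormedSpace ℝ E] {K : ℕ} {B : ℝ}
    (hB : 0 ≤ B) {f : Fin K → E} (hf : ∀ k, ‖f k‖ ≤ B) : ‖(1 / (K : ℝ)) • ∑ k, f k‖ ≤ B := by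
  rcases K.eq_zero_or_pos with rfl | hK
  · simpa using hB
  · have hK' : (0 : ℝ) < K := Nat.cast_pos.2 hK
    rw [norm_smul, Real.norm_of_nonneg (by positivity), one_div, inv_mul_le_iff₀ hK']
    calc ‖∑ k, f k‖ ≤ ∑ k, ‖f k‖ := norm_sum_le _ _
      _ ≤ ∑ _k : Fin K, B := Finset.sum_le_sum fun k _ => hf k
      _ = K * B := by simp

theorem exists_norm_le_on_closedBall {E E' ι : Type*} [Fintype ι] [SeminormedAddCommGroup E]
    [ProperSpace E] [SeminormedAddCommGroup E'] {g : ι → E → E'} (hg : ∀ i, Continuous (g i))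
    (R : ℝ) : ∃ B, 0 ≤ B ∧ ∀ i x, ‖x‖ ≤ R → ‖g i x‖ ≤ B := by
  have : ∀ i, ∃ B, ∀ x ∈ Metric.closedBall (0 : E) R, ‖g i x‖ ≤ B := fun i =>
    (isCompact_closedBall (0 : E) R).exists_bound_of_continuousOn (hg i).continuousOn
  choose B hB using this
  refine ⟨∑ i, |B i|, by positivity, fun i x hx => ?_⟩
  exact ((hB i x (by simpa using hx)).trans (le_abs_self _)).trans
    (Finset.single_le_sum (f := fun i => |B i|) (fun _ _ => abs_nonneg _) (Finset.mem_univ i))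

end Sequences

/-! ### Optimality conditions and stability of minimizers. -/

section ConvexAnalysis

variable {E : Type*} [NormedAddCommGroup E] [InnerProductSpace ℝ E]

/-- First-order optimality condition for the sum of a differentiable function and a (strongly)
convex one. -/
theorem strong_subgradient_of_isMin [CompleteSpace E] {ψ r : E → ℝ} {lam m : ℝ} {g v : E}
    (hψ : HasGradientAt ψ g v) (hr : StrongConvexOn Set.univ m r) (hlam : 0 ≤ lam)
    (hmin : ∀ u, ψ v + lam * r v ≤ ψ u + lam * r u) (u : E) :
    lam * r v - inner ℝ g (u - v) + lam * (m / 2 * ‖u - v‖ ^ 2) ≤ lam * r u := by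
  have hline : HasDerivAt (fun t : ℝ => ψ (v + t • (u - v))) (inner ℝ g (u - v)) 0 := by
    have h1 : HasDerivAt (fun t : ℝ => v + t • (u - v)) (u - v) 0 := by
      simpa using ((hasDerivAt_id (0 : ℝ)).smul_const (u - v)).const_add v
    have h2 : HasFDerivAt ψ (InnerProductSpace.toDual ℝ E g) (v + (0 : ℝ) • (u - v)) := by
      simpa using hψ.hasFDerivAt
    have h3 := h2.comp_hasDerivAt (0 : ℝ) h1
    rwa [InnerProductSpace.toDual_apply_apply] at h3
  have hlim1 := hline.tendsto_slope_zero_right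
  have hlim2 : Tendsto (fun t : ℝ => lam * (r u - r v - (1 - t) * (m / 2 * ‖u - v‖ ^ 2)))
      (𝓝[>] 0) (𝓝 (lam * (r u - r v - (1 - 0) * (m / 2 * ‖u - v‖ ^ 2)))) := by
    refine Tendsto.mono_left ?_ nhdsWithin_le_nhds
    exact Continuous.tendsto (by fun_prop) 0
  -- Compare v with the nearby point v + t(u - v), bound r there by strong convexity, and divide by
  -- t.
  have key : ∀ᶠ t : ℝ in 𝓝[>] 0, 0 ≤ t⁻¹ • (ψ (v + (0 + t) • (u - v)) - ψ (v + (0 : ℝ) • (u - v)))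
      + lam * (r u - r v - (1 - t) * (m / 2 * ‖u - v‖ ^ 2)) := by
    filter_upwards [Ioo_mem_nhdsGT (show (0 : ℝ) < 1 by norm_num)] with t ht
    have h1 := hr.2 (Set.mem_univ v) (Set.mem_univ u) (by linarith [ht.2] : 0 ≤ 1 - t) ht.1.le
      (by ring)
    have hp : (1 - t) • v + t • u = v + t • (u - v) := by
      rw [smul_sub, sub_smul, one_smul]; abel
    rw [hp, norm_sub_rev] at h1
    simp only [smul_eq_mul] at h1
    have h2 := hmin (v + t • (u - v))
    have h3 := mul_le_mul_of_nonneg_left h1 hlam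
    rw [zero_add, zero_smul, add_zero, smul_eq_mul]
    have h4 : 0 ≤ t * (t⁻¹ * (ψ (v + t • (u - v)) - ψ v)
      + lam * (r u - r v - (1 - t) * (m / 2 * ‖u - v‖ ^ 2))) := by
      rw [mul_add, mul_inv_cancel_left₀ ht.1.ne']
      nlinarith
    exact nonneg_of_mul_nonneg_right h4 ht.1
  have := ge_of_tendsto (hlim1.add hlim2) key
  linarith

/-- The sum of -φ and φ is constant, so every point minimizes it and the optimality condition
applies with smooth part -φ. -/
theorem inner_gradient_le_of_convexOn [CompleteSpace E] {φ : E → ℝ} {g v : E}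
    (hφ : ConvexOn ℝ Set.univ φ) (hg : HasGradientAt φ g v) (u : E) :
    φ v + inner ℝ g (u - v) ≤ φ u := by
  have hneg : HasGradientAt (fun u => -φ u) (-g) v := by
    rw [hasGradientAt_iff_hasFDerivAt, map_neg]
    exact hg.hasFDerivAt.neg
  have := strong_subgradient_of_isMin (lam := 1) hneg (strongConvexOn_zero.2 hφ) zero_le_one
    (fun u => by simp) u
  simp only [inner_neg_left] at this
  linarith

theorem inner_gradient_sub_nonneg [CompleteSpace E] {φ : E → ℝ} {g g' u v : E}
    (hφ : ConvexOn ℝ Set.univ φ) (hg : HasGradientAt φ g v) (hg' : HasGradientAt φ g' u) :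
    0 ≤ inner ℝ (g' - g) (u - v) := by
  have h1 := inner_gradient_le_of_convexOn hφ hg u
  have h2 := inner_gradient_le_of_convexOn hφ hg' v
  rw [← neg_sub u v, inner_neg_right] at h2
  rw [inner_sub_left]
  linarith

/-- Solutions of two strongly monotone inclusions are close when the data are, up to a monotone
perturbation `p` of the data. -/
theorem norm_sub_le_of_strong_subgradient {r : E → ℝ} {lam m τ : ℝ}
    {w w' v v' h h' p : E} (hτ : 0 ≤ τ)
    (hopt : ∀ u, lam * r v - inner ℝ (h + (2 * τ) • (v - w)) (u - v) +
      lam * (m / 2 * ‖u - v‖ ^ 2) ≤ lam * r u)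
    (hopt' : ∀ u, lam * r v' - inner ℝ (h' + p + (2 * τ) • (v' - w')) (u - v') +
      lam * (m / 2 * ‖u - v'‖ ^ 2) ≤ lam * r u)
    (hp : 0 ≤ inner ℝ p (v' - v)) :
    (2 * τ + lam * m) * ‖v' - v‖ ≤ ‖h' - h‖ + 2 * τ * ‖w' - w‖ := by
  have h1 := hopt v'
  have h2 := hopt' v
  rw [norm_sub_rev v v'] at h2
  -- Test each inequality at the other solution and add: the values of r cancel, the two halves of m
  -- combine, and the monotone term p has a favourable sign.
  have h3 : (2 * τ + lam * m) * ‖v' - v‖ ^ 2 ≤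
      inner ℝ (-(h' - h) + (2 * τ) • (w' - w)) (v' - v) := by
    have e1 : inner ℝ (h' + p + (2 * τ) • (v' - w')) (v - v') =
        -inner ℝ (h' + p + (2 * τ) • (v' - w')) (v' - v) := by
      rw [← inner_neg_right, neg_sub]
    have e2 : inner ℝ (h' + p + (2 * τ) • (v' - w')) (v' - v) =
        inner ℝ (h + (2 * τ) • (v - w)) (v' - v) + inner ℝ p (v' - v)
        + 2 * τ * ‖v' - v‖ ^ 2 - inner ℝ (-(h' - h) + (2 * τ) • (w' - w)) (v' - v) := by
      rw [← real_inner_self_eq_norm_sq, ← real_inner_smul_left, ← inner_add_left, ← inner_add_left,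
        ← inner_sub_left]
      congr 1
      module
    rw [e1, e2] at h2
    linarith
  have h4 : inner ℝ (-(h' - h) + (2 * τ) • (w' - w)) (v' - v) ≤
      (‖h' - h‖ + 2 * τ * ‖w' - w‖) * ‖v' - v‖ := by
    refine (real_inner_le_norm _ _).trans (mul_le_mul_of_nonneg_right ?_ (norm_nonneg _))
    refine (norm_add_le _ _).trans ?_
    rw [norm_neg, norm_smul, Real.norm_of_nonneg (by positivity)]
  rcases (norm_nonneg (v' - v)).eq_or_lt with h0 | h0
  · rw [← h0, mul_zero]
    positivity
  · refine le_of_mul_le_mul_right ?_ h0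
    rw [mul_assoc, ← sq]
    exact h3.trans h4

end ConvexAnalysis

/-! ### One-step estimates for the tracking error and the objective. -/

section OneStep

variable {E : Type*} [NormedAddCommGroup E] [InnerProductSpace ℝ E]

/-- One step of the recursion for the tracking error. -/
theorem norm_sq_averaging_step_le {ρ : ℝ} (hρ : 0 < ρ) (hρ1 : ρ ≤ 1) (e ξ δ : E) :
    ‖(1 - ρ) • e + ρ • ξ + δ‖ ^ 2 ≤ (1 - ρ / 2) * ‖e‖ ^ 2 + 2 * (1 - ρ) * ρ * inner ℝ e ξ
      + 2 * ρ ^ 2 * ‖ξ‖ ^ 2 + 4 / ρ * ‖δ‖ ^ 2 := by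
  have h1 : ‖(1 - ρ) • e + ρ • ξ + δ‖ ^ 2 = (1 - ρ) ^ 2 * ‖e‖ ^ 2 + 2 * (1 - ρ) * ρ * inner ℝ e ξ
      + 2 * (1 - ρ) * inner ℝ e δ + ‖ρ • ξ + δ‖ ^ 2 := by
    rw [add_assoc, norm_add_sq_real, norm_smul, mul_pow, Real.norm_eq_abs, sq_abs, inner_add_right,
      real_inner_smul_left, real_inner_smul_left, real_inner_smul_right]
    ring
  have h2 : ‖ρ • ξ + δ‖ ^ 2 ≤ 2 * ρ ^ 2 * ‖ξ‖ ^ 2 + 2 * ‖δ‖ ^ 2 := by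
    have := norm_add_le (ρ • ξ) δ
    rw [norm_smul, Real.norm_of_nonneg hρ.le] at this
    calc ‖ρ • ξ + δ‖ ^ 2 ≤ (ρ * ‖ξ‖ + ‖δ‖) ^ 2 := pow_le_pow_left₀ (norm_nonneg _) this 2
      _ ≤ _ := by nlinarith [sq_nonneg (ρ * ‖ξ‖ - ‖δ‖)]
  -- Young's inequality, weighted to spend exactly half of the contraction ρ‖e‖².
  have h3 : 2 * (1 - ρ) * inner ℝ e δ ≤ ρ / 2 * ‖e‖ ^ 2 + 2 / ρ * ‖δ‖ ^ 2 := by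
    have h4 : 2 * (1 - ρ) * inner ℝ e δ ≤ 2 * (‖e‖ * ‖δ‖) := by
      have h5 : (1 - ρ) * inner ℝ e δ ≤ (1 - ρ) * (‖e‖ * ‖δ‖) :=
        mul_le_mul_of_nonneg_left (real_inner_le_norm e δ) (by linarith)
      have h6 : 0 ≤ ρ * (‖e‖ * ‖δ‖) := by positivity
      linarith
    have h7 : ρ / 2 * ‖e‖ ^ 2 + 2 / ρ * ‖δ‖ ^ 2 - 2 * (‖e‖ * ‖δ‖) =
        (ρ * ‖e‖ - 2 * ‖δ‖) ^ 2 / (2 * ρ) := by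
      field_simp
      ring
    have h8 : 0 ≤ (ρ * ‖e‖ - 2 * ‖δ‖) ^ 2 / (2 * ρ) := by positivity
    linarith
  have h9 : (1 - ρ) ^ 2 * ‖e‖ ^ 2 ≤ (1 - ρ) * ‖e‖ ^ 2 :=
    mul_le_mul_of_nonneg_right (by nlinarith) (sq_nonneg _)
  have h10 : 2 * ‖δ‖ ^ 2 ≤ 2 / ρ * ‖δ‖ ^ 2 :=
    mul_le_mul_of_nonneg_right (by rw [le_div_iff₀ hρ]; linarith) (sq_nonneg _)
  have h11 : 4 / ρ * ‖δ‖ ^ 2 = 2 / ρ * ‖δ‖ ^ 2 + 2 / ρ * ‖δ‖ ^ 2 := by ring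
  linarith

/-- One step of the objective along the relaxed surrogate minimizer. -/
theorem objective_step_le {F r : E → ℝ} {lam m τ α K : ℝ} {w w' v h g : E}
    (hlam : 0 ≤ lam) (hα : 0 ≤ α) (hα1 : α ≤ 1) (hr : ConvexOn ℝ Set.univ r)
    (hw' : w' = (1 - α) • w + α • v)
    (hF : F w' ≤ F w + inner ℝ g (w' - w) + K * ‖w' - w‖ ^ 2)
    (hopt : ∀ u, lam * r v - inner ℝ (h + (2 * τ) • (v - w)) (u - v) +
      lam * (m / 2 * ‖u - v‖ ^ 2) ≤ lam * r u) :
    F w' + lam * r w' ≤ F w + lam * r w - α * ((2 * τ + lam * m / 2) * ‖v - w‖ ^ 2)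
      + α * (‖g - h‖ * ‖v - w‖) + K * (α ^ 2 * ‖v - w‖ ^ 2) := by
  have hstep : w' - w = α • (v - w) := by rw [hw']; module
  rw [hstep, real_inner_smul_right, norm_smul, mul_pow, Real.norm_eq_abs, sq_abs] at hF
  have h1 := hr.2 (Set.mem_univ w) (Set.mem_univ v) (by linarith : 0 ≤ 1 - α) hα (by ring)
  rw [← hw', smul_eq_mul, smul_eq_mul] at h1
  have h1' := mul_le_mul_of_nonneg_left h1 hlam
  -- Testing optimality at the current iterate makes v - w a descent direction.
  have h2 := hopt w
  rw [← neg_sub v w, inner_neg_right, norm_neg, inner_add_left, real_inner_smul_left,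
    real_inner_self_eq_norm_sq] at h2
  have h3 : inner ℝ g (v - w) - inner ℝ h (v - w) ≤ ‖g - h‖ * ‖v - w‖ := by
    rw [← inner_sub_left]; exact real_inner_le_norm _ _
  have h4 := mul_le_mul_of_nonneg_left h3 hα
  have h5 := mul_le_mul_of_nonneg_left h2 hα
  nlinarith

end OneStep

/-! ### Pathwise Lyapunov analysis. -/

section Deterministic

variable {E : Type*} [NormedAddCommGroup E] [InnerProductSpace ℝ E]

/-- Pathwise convergence: the tracking errors `d n - G (w n)` and the surrogate steps `v n - w n`
vanish as soon as the accumulated noise converges. -/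
theorem tendsto_zero_of_noise_converges {F r : E → ℝ} {G : E → E} {lam m τ K R B C Umin l : ℝ}
    {α ρ : ℕ → ℝ} {w v d h s : ℕ → E}
    (hlam : 0 ≤ lam) (hm : 0 ≤ m) (hτ : 0 ≤ τ) (hc : 0 < 2 * τ + lam * m)
    (hr : ConvexOn ℝ Set.univ r)
    (hα : IsDiminishing α) (hρ : IsDiminishing ρ) (hρ_pos : ∀ n, 0 < ρ n)
    (hαρ : Tendsto (fun n => α n / ρ n) atTop (𝓝 0))
    (hΔ : ∀ n, ‖v n - w n‖ ≤ R) (hξ : ∀ n, ‖s n - G (w n)‖ ≤ B)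
    (hw : ∀ n, w (n + 1) = (1 - α n) • w n + α n • v n)
    (hd : ∀ n, d (n + 1) = (1 - ρ n) • d n + ρ n • s n)
    (hK : 0 ≤ K) (hG : ∀ i j, ‖G (w i) - G (w j)‖ ≤ K * ‖w i - w j‖)
    (hF : ∀ n, F (w (n + 1)) ≤ F (w n) + inner ℝ (G (w n)) (w (n + 1) - w n)
      + K * ‖w (n + 1) - w n‖ ^ 2)
    (hU : ∀ n, Umin ≤ F (w n) + lam * r (w n))
    (hh : ∀ n, ‖h n - d n‖ ≤ C * ρ n)
    (hopt : ∀ n u, lam * r (v n) - inner ℝ (h n + (2 * τ) • (v n - w n)) (u - v n) +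
      lam * (m / 2 * ‖u - v n‖ ^ 2) ≤ lam * r u)
    (hnoise : Tendsto (fun n => ∑ k ∈ Finset.range n,
      2 * (1 - ρ k) * ρ k * inner ℝ (d k - G (w k)) (s k - G (w k))) atTop (𝓝 l)) :
    Tendsto (fun n => d n - G (w n)) atTop (𝓝 0) ∧ Tendsto (fun n => v n - w n) atTop (𝓝 0) := by
  have hR : 0 ≤ R := (norm_nonneg _).trans (hΔ 0)
  have hB : 0 ≤ B := (norm_nonneg _).trans (hξ 0)
  have hC : 0 ≤ C := nonneg_of_mul_nonneg_left ((norm_nonneg _).trans (hh 0)) (hρ_pos 0)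
  set c : ℝ := 2 * τ + lam * m / 2 with hc_def
  have hlm : 0 ≤ lam * m := mul_nonneg hlam hm
  have hc0 : 0 < c := by rw [hc_def]; linarith
  set e : ℕ → E := fun n => d n - G (w n) with he
  set N : ℕ → ℝ := fun k => 2 * (1 - ρ k) * ρ k * inner ℝ (e k) (s k - G (w k)) with hN
  have hstep : ∀ n, w (n + 1) - w n = α n • (v n - w n) := fun n => by rw [hw]; module
  have hstep_norm : ∀ n, ‖w (n + 1) - w n‖ = α n * ‖v n - w n‖ := fun n => by
    rw [hstep, norm_smul, Real.norm_of_nonneg (hα.nonneg n)]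
  have hα1 : ∀ᶠ n in atTop, α n ≤ 1 :=
    (hα.tendsto_zero.eventually_lt_const zero_lt_one).mono fun _ h => h.le
  have hρ1 : ∀ᶠ n in atTop, ρ n ≤ 1 :=
    (hρ.tendsto_zero.eventually_lt_const zero_lt_one).mono fun _ h => h.le
  -- The two uses of α/ρ → 0: `hq1` lets the contraction of e absorb its effect on the objective,
  -- and `hq2` lets the descent absorb the drift of G.
  have hq1 : ∀ᶠ n in atTop, α n ≤ c / 4 * ρ n := by
    filter_upwards [hαρ.eventually_lt_const (show 0 < c / 4 by positivity)] with n hn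
    exact ((div_lt_iff₀ (hρ_pos n)).1 hn).le
  have hq2 : ∀ᶠ n in atTop, 4 * K ^ 2 * (α n / ρ n) ≤ c / 4 := by
    have : Tendsto (fun n => 4 * K ^ 2 * (α n / ρ n)) atTop (𝓝 0) := by
      simpa using hαρ.const_mul (4 * K ^ 2)
    exact (this.eventually_lt_const (show 0 < c / 4 by positivity)).mono fun _ h => h.le
  have herr : ∀ᶠ n in atTop, ‖e (n + 1)‖ ^ 2 ≤ (1 - ρ n / 2) * ‖e n‖ ^ 2 + N n
      + 2 * B ^ 2 * ρ n ^ 2 + c / 4 * (α n * ‖v n - w n‖ ^ 2) := by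
    filter_upwards [hρ1, hq2] with n hρn hq
    have h1 := norm_sq_averaging_step_le (hρ_pos n) hρn (e n) (s n - G (w n))
      (G (w n) - G (w (n + 1)))
    have h2 : (1 - ρ n) • e n + ρ n • (s n - G (w n)) + (G (w n) - G (w (n + 1))) = e (n + 1) := by
      simp only [he, hd]; module
    rw [h2] at h1
    have h3 : ‖s n - G (w n)‖ ^ 2 ≤ B ^ 2 := pow_le_pow_left₀ (norm_nonneg _) (hξ n) 2
    have h4 : ‖G (w n) - G (w (n + 1))‖ ≤ K * (α n * ‖v n - w n‖) := by
      rw [← hstep_norm, norm_sub_rev (w (n + 1))]; exact hG _ _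
    have h5 := pow_le_pow_left₀ (norm_nonneg _) h4 2
    have h6 : 4 / ρ n * ‖G (w n) - G (w (n + 1))‖ ^ 2 ≤ c / 4 * (α n * ‖v n - w n‖ ^ 2) := by
      calc 4 / ρ n * ‖G (w n) - G (w (n + 1))‖ ^ 2
          ≤ 4 / ρ n * (K * (α n * ‖v n - w n‖)) ^ 2 :=
            mul_le_mul_of_nonneg_left h5 (by have := hρ_pos n; positivity)
        _ = 4 * K ^ 2 * (α n / ρ n) * (α n * ‖v n - w n‖ ^ 2) := by ring
        _ ≤ _ := mul_le_mul_of_nonneg_right hq (mul_nonneg (hα.nonneg n) (sq_nonneg _))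
    have h7 : 2 * ρ n ^ 2 * ‖s n - G (w n)‖ ^ 2 ≤ 2 * B ^ 2 * ρ n ^ 2 := by
      nlinarith [sq_nonneg (ρ n)]
    linarith
  set z : ℕ → ℝ := fun n => (2 * B ^ 2 + C * R) * ρ n ^ 2 + (C * R + K * R ^ 2) * α n ^ 2 with hz
  have hzsum : Summable z := (hρ.summable_sq.mul_left _).add (hα.summable_sq.mul_left _)
  -- Of the descent coefficient c, one quarter goes to Young's inequality and one quarter to the
  -- drift; of the contraction ρ/2, ρ/4 goes to the error in the descent direction.
  have hlyap : ∀ᶠ n in atTop, F (w (n + 1)) + lam * r (w (n + 1)) + ‖e (n + 1)‖ ^ 2 ≤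
      F (w n) + lam * r (w n) + ‖e n‖ ^ 2
        - (c / 2 * (α n * ‖v n - w n‖ ^ 2) + 1 / 4 * (ρ n * ‖e n‖ ^ 2)) + (N n + z n) := by
    filter_upwards [hα1, hq1, herr] with n hαn hq hen
    have hα0 := hα.nonneg n
    have hρ0 := hρ_pos n
    have h1 := objective_step_le hlam hα0 hαn hr (hw n) (hF n) (hopt n)
    rw [← hc_def] at h1
    have h2 : ‖G (w n) - h n‖ ≤ ‖e n‖ + C * ρ n := by
      have : G (w n) - h n = -(e n + (h n - d n)) := by simp only [he]; abel
      rw [this, norm_neg]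
      exact (norm_add_le _ _).trans (add_le_add le_rfl (hh n))
    have h3 : ‖G (w n) - h n‖ * ‖v n - w n‖ ≤
        c / 4 * ‖v n - w n‖ ^ 2 + 1 / c * ‖e n‖ ^ 2 + C * R * ρ n := by
      have h4 : ‖e n‖ * ‖v n - w n‖ ≤ c / 4 * ‖v n - w n‖ ^ 2 + 1 / c * ‖e n‖ ^ 2 := by
        have : c / 4 * ‖v n - w n‖ ^ 2 + 1 / c * ‖e n‖ ^ 2 - ‖e n‖ * ‖v n - w n‖ =
            (c * ‖v n - w n‖ - 2 * ‖e n‖) ^ 2 / (4 * c) := by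
          field_simp; ring
        have : 0 ≤ (c * ‖v n - w n‖ - 2 * ‖e n‖) ^ 2 / (4 * c) := by positivity
        linarith
      have h5 : C * ρ n * ‖v n - w n‖ ≤ C * ρ n * R :=
        mul_le_mul_of_nonneg_left (hΔ n) (by positivity)
      have h6 := mul_le_mul_of_nonneg_right h2 (norm_nonneg (v n - w n))
      linarith
    have h7 := mul_le_mul_of_nonneg_left h3 hα0
    have h8 : α n * (1 / c * ‖e n‖ ^ 2) ≤ 1 / 4 * (ρ n * ‖e n‖ ^ 2) := by
      have : α n * (1 / c) ≤ 1 / 4 * ρ n := by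
        rw [mul_one_div, div_le_iff₀ hc0]; linarith
      have := mul_le_mul_of_nonneg_right this (sq_nonneg ‖e n‖)
      linarith
    have h9 : K * (α n ^ 2 * ‖v n - w n‖ ^ 2) ≤ K * R ^ 2 * α n ^ 2 := by
      have h10 := pow_le_pow_left₀ (norm_nonneg _) (hΔ n) 2
      have h11 := mul_le_mul_of_nonneg_left h10 (mul_nonneg hK (sq_nonneg (α n)))
      linarith
    have h12 : α n * (C * R * ρ n) ≤ C * R * ρ n ^ 2 + C * R * α n ^ 2 := by
      have h13 : α n * ρ n ≤ ρ n ^ 2 + α n ^ 2 := by nlinarith [sq_nonneg (α n - ρ n)]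
      have h14 := mul_le_mul_of_nonneg_left h13 (mul_nonneg hC hR)
      linarith
    simp only [hz]
    linarith
  have hsum : Summable fun n =>
      c / 2 * (α n * ‖v n - w n‖ ^ 2) + 1 / 4 * (ρ n * ‖e n‖ ^ 2) := by
    refine summable_of_descent (x := fun n => F (w n) + lam * r (w n) + ‖e n‖ ^ 2)
      (z := fun n => N n + z n) (B := Umin) (l := l + ∑' n, z n) (fun n => ?_) (fun n => ?_) ?_ hlyap
    · have := hα.nonneg n
      have := hρ.nonneg n
      positivity
    · have := hU n
      have := sq_nonneg ‖e n‖
      linarith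
    · simp only [Finset.sum_add_distrib]
      exact hnoise.add hzsum.hasSum.tendsto_sum_nat
  have hsumΔ : Summable fun n => α n * ‖v n - w n‖ ^ 2 := by
    refine Summable.of_nonneg_of_le (fun n => mul_nonneg (hα.nonneg n) (sq_nonneg _)) (fun n => ?_)
      (hsum.mul_left (2 / c))
    have h1 : 2 / c * (c / 2 * (α n * ‖v n - w n‖ ^ 2) + 1 / 4 * (ρ n * ‖e n‖ ^ 2)) =
        α n * ‖v n - w n‖ ^ 2 + 2 / c * (1 / 4 * (ρ n * ‖e n‖ ^ 2)) := by field_simp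
    have := hρ.nonneg n
    rw [h1]
    exact le_add_of_nonneg_right (by positivity)
  have hsumE : Summable fun n => ρ n * ‖e n‖ ^ 2 := by
    refine Summable.of_nonneg_of_le (fun n => mul_nonneg (hρ.nonneg n) (sq_nonneg _)) (fun n => ?_)
      (hsum.mul_left 4)
    have := hα.nonneg n
    have : 0 ≤ c / 2 * (α n * ‖v n - w n‖ ^ 2) := by positivity
    linarith
  -- Discarding the contraction leaves a perturbed descent for ‖e‖² alone, so it has a limit; the
  -- divergence of Σ ρ then identifies the limit as 0.
  have hE : Tendsto (fun n => ‖e n‖ ^ 2) atTop (𝓝 0) := by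
    have hs : Summable fun n => 2 * B ^ 2 * ρ n ^ 2 + c / 4 * (α n * ‖v n - w n‖ ^ 2) :=
      (hρ.summable_sq.mul_left _).add (hsumΔ.mul_left _)
    obtain ⟨a, ha⟩ := tendsto_of_descent (x := fun n => ‖e n‖ ^ 2) (B := 0)
      (z := fun n => N n + (2 * B ^ 2 * ρ n ^ 2 + c / 4 * (α n * ‖v n - w n‖ ^ 2)))
      (fun n => sq_nonneg _)
      (by simpa only [Finset.sum_add_distrib (f := N)] using
        hnoise.add hs.hasSum.tendsto_sum_nat)
      (herr.mono fun n hn => by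
        have : 0 ≤ ρ n / 2 * ‖e n‖ ^ 2 := mul_nonneg (half_pos (hρ_pos n)).le (sq_nonneg _)
        linarith)
    exact tendsto_zero_of_summable_mul hρ.nonneg hρ.sum_eq_top (fun n => sq_nonneg _) hsumE ha
  have he0 : Tendsto (fun n => ‖e n‖) atTop (𝓝 0) := by
    have := hE.sqrt
    simpa [Real.sqrt_sq (norm_nonneg _)] using this
  refine ⟨tendsto_zero_iff_norm_tendsto_zero.2 he0, tendsto_zero_iff_norm_tendsto_zero.2 ?_⟩
  -- Here m enters in full, unlike in c: two optimality conditions are added, whereas the descent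
  -- estimate used only one.
  set c' : ℝ := 2 * τ + lam * m with hc'
  refine tendsto_zero_of_summable_mul_sq (x := w) (a := α) (C := (K + 2 * τ) / c' + 1)
    (η := fun n => (‖e n‖ + C * ρ n) / c') hα.nonneg hα.sum_eq_top (fun n => norm_nonneg _) hsumΔ ?_
    (by positivity) (fun n => (hstep_norm n).le) ?_
  · simpa using (he0.add (hρ.tendsto_zero.const_mul C)).div_const c'
  · intro i j
    have h1 := norm_sub_le_of_strong_subgradient (p := 0) hτ (hopt i)
      (by simpa using hopt j) (by simp)
    have hne : ∀ n, ‖h n - G (w n)‖ ≤ ‖e n‖ + C * ρ n := fun n => by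
      have : h n - G (w n) = e n + (h n - d n) := by simp only [he]; abel
      rw [this]
      exact (norm_add_le _ _).trans (add_le_add le_rfl (hh n))
    have h2 : ‖h j - h i‖ ≤ (‖e j‖ + C * ρ j) + K * ‖w i - w j‖ + (‖e i‖ + C * ρ i) := by
      have : h j - h i = (h j - G (w j)) + (G (w j) - G (w i)) - (h i - G (w i)) := by abel
      rw [this]
      refine (norm_sub_le _ _).trans (add_le_add ((norm_add_le _ _).trans
        (add_le_add (hne j) ?_)) (hne i))
      rw [norm_sub_rev (w i)]
      exact hG j i
    have h3 : ‖v j - v i‖ ≤ (‖e j‖ + C * ρ j) / c' + (‖e i‖ + C * ρ i) / c' +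
        (K + 2 * τ) / c' * ‖w i - w j‖ := by
      rw [div_mul_eq_mul_div, ← add_div, ← add_div, le_div_iff₀ hc]
      rw [norm_sub_rev (w j)] at h1
      linarith
    have h4 : ‖v j - w j‖ ≤ ‖v j - v i‖ + ‖v i - w i‖ + ‖w i - w j‖ := by
      have : v j - w j = (v j - v i) + (v i - w i) + (w i - w j) := by abel
      rw [this]
      exact (norm_add_le _ _).trans (add_le_add (norm_add_le _ _) le_rfl)
    linarith

end Deterministic

/-! ### Almost sure convergence of the sampling noise. -/

section Noise

variable {Ω : Type*} {mΩ : MeasurableSpace Ω} {μ : Measure Ω} [IsProbabilityMeasure μ]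
  {ℱ : Filtration ℕ mΩ}

/-- The partial sums of bounded martingale differences with square-summable bounds converge. -/
theorem ae_tendsto_sum_of_martingale_difference {X : ℕ → Ω → ℝ} {c : ℕ → ℝ}
    (hmeas : ∀ n, StronglyMeasurable[ℱ (n + 1)] (X n)) (hbound : ∀ n ω, |X n ω| ≤ c n)
    (hc : Summable fun n => c n ^ 2) (hzero : ∀ n, μ[X n | ℱ n] =ᵐ[μ] 0) :
    ∀ᵐ ω ∂μ, ∃ l, Tendsto (fun n => ∑ k ∈ Finset.range n, X k ω) atTop (𝓝 l) := by
  set M : ℕ → Ω → ℝ := fun n ω => ∑ k ∈ Finset.range n, X k ω with hM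
  have hMadp : StronglyAdapted ℱ M := fun n =>
    Finset.stronglyMeasurable_fun_sum _ fun k hk =>
      (hmeas k).mono (ℱ.mono (Finset.mem_range.1 hk))
  have hMbound : ∀ n ω, ‖M n ω‖ ≤ ∑ k ∈ Finset.range n, c k := fun n ω =>
    (norm_sum_le _ _).trans (Finset.sum_le_sum fun k _ => hbound k ω)
  have hXint : ∀ n, Integrable (X n) μ := fun n =>
    .of_bound ((hmeas n).mono (ℱ.le _)).aestronglyMeasurable (c n) (ae_of_all _ (hbound n))
  have hMint : ∀ n, Integrable (M n) μ := fun n =>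
    .of_bound ((hMadp n).mono (ℱ.le _)).aestronglyMeasurable _ (ae_of_all _ (hMbound n))
  have hmart : Martingale M ℱ μ := by
    refine martingale_of_condExp_sub_eq_zero_nat hMadp hMint fun n => ?_
    have : M (n + 1) - M n = X n := by
      ext ω
      simp [hM, Finset.sum_range_succ]
    rw [this]
    exact hzero n
  -- Orthogonality of the increments, so that second moments add up.
  have hcross : ∀ n, ∫ ω, M n ω * X n ω ∂μ = 0 := by
    intro n
    have h1 := condExp_stronglyMeasurable_mul_of_bound (ℱ.le n) (hMadp n) (hXint n) _
      (ae_of_all μ (hMbound n))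
    have h2 : μ[M n * X n | ℱ n] =ᵐ[μ] 0 := by
      filter_upwards [h1, hzero n] with ω h1 h2
      rw [h1, Pi.mul_apply, h2]
      simp
    calc ∫ ω, M n ω * X n ω ∂μ = ∫ ω, (μ[M n * X n | ℱ n]) ω ∂μ :=
          (integral_condExp (ℱ.le n)).symm
      _ = 0 := by rw [integral_congr_ae h2]; simp
  have hMXint : ∀ n, Integrable (fun ω => M n ω * X n ω) μ := fun n =>
    (hXint n).bdd_mul ((hMadp n).mono (ℱ.le _)).aestronglyMeasurable (ae_of_all _ (hMbound n))
  have hXsq : ∀ n, Integrable (fun ω => X n ω ^ 2) μ := fun n => by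
    simp only [sq]
    exact (hXint n).bdd_mul ((hmeas n).mono (ℱ.le _)).aestronglyMeasurable
      (ae_of_all _ (hbound n))
  have hMsq : ∀ n, Integrable (fun ω => M n ω ^ 2) μ := fun n => by
    simp only [sq]
    exact (hMint n).bdd_mul ((hMadp n).mono (ℱ.le _)).aestronglyMeasurable
      (ae_of_all _ (hMbound n))
  have hsecond : ∀ n, ∫ ω, M n ω ^ 2 ∂μ ≤ ∑ k ∈ Finset.range n, c k ^ 2 := by
    intro n
    induction n with
    | zero => simp [hM]
    | succ n ih =>
      have h1 : ∀ ω, M (n + 1) ω ^ 2 = M n ω ^ 2 + 2 * (M n ω * X n ω) + X n ω ^ 2 := fun ω => by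
        simp only [hM, Finset.sum_range_succ]
        ring
      have h2 : ∫ ω, X n ω ^ 2 ∂μ ≤ c n ^ 2 := by
        calc ∫ ω, X n ω ^ 2 ∂μ ≤ ∫ _, c n ^ 2 ∂μ :=
              integral_mono (hXsq n) (integrable_const _) fun ω => by
                simpa only [sq_abs] using pow_le_pow_left₀ (abs_nonneg _) (hbound n ω) 2
          _ = c n ^ 2 := by simp
      have h3 : ∫ ω, M (n + 1) ω ^ 2 ∂μ =
          ∫ ω, M n ω ^ 2 ∂μ + 2 * ∫ ω, M n ω * X n ω ∂μ + ∫ ω, X n ω ^ 2 ∂μ := by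
        rw [← integral_const_mul, ← integral_add (hMsq n) ((hMXint n).const_mul 2),
          ← integral_add (by exact (hMsq n).add ((hMXint n).const_mul 2)) (hXsq n)]
        exact integral_congr_ae (ae_of_all _ h1)
      rw [h3, hcross, Finset.sum_range_succ]
      linarith
  have hL1 : ∀ n, eLpNorm (M n) 1 μ ≤ ((1 + ∑' n, c n ^ 2).toNNReal : ℝ≥0) := by
    intro n
    rw [eLpNorm_one_eq_lintegral_enorm, ← ofReal_integral_norm_eq_lintegral_enorm (hMint n)]
    refine ENNReal.ofReal_le_ofReal ?_
    calc ∫ ω, ‖M n ω‖ ∂μ ≤ ∫ ω, (1 + M n ω ^ 2) ∂μ :=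
          integral_mono (hMint n).norm ((integrable_const _).add (hMsq n)) fun ω => by
            have h1 := sq_abs (M n ω)
            change |M n ω| ≤ 1 + M n ω ^ 2
            nlinarith [sq_nonneg (|M n ω| - 1)]
      _ = 1 + ∫ ω, M n ω ^ 2 ∂μ := by
          rw [integral_add (integrable_const _) (hMsq n)]; simp
      _ ≤ 1 + ∑' n, c n ^ 2 := by
          have := hc.sum_le_tsum (Finset.range n) fun k _ => sq_nonneg (c k)
          linarith [hsecond n]
  filter_upwards [hmart.submartingale.ae_tendsto_limitProcess hL1] with ω hω
  exact ⟨_, hω⟩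

/-- A mini-batch average is conditionally unbiased. -/
theorem condExp_batch_average_sub {N L : ℕ} (hL : 0 < L) {b : ℕ → Ω → Fin L → Fin N}
    (hb : IsMiniBatchSampling μ ℱ b) (n : ℕ) {H : Fin N → Ω → ℝ} {C : ℝ}
    (hH : ∀ i, StronglyMeasurable[ℱ n] (H i)) (hHC : ∀ i ω, ‖H i ω‖ ≤ C) :
    μ[fun ω => (1 / (L : ℝ)) * ∑ j, H (b n ω j) ω - (1 / (N : ℝ)) * ∑ i, H i ω | ℱ n] =ᵐ[μ] 0 := by
  have hL' : (L : ℝ) ≠ 0 := Nat.cast_ne_zero.2 hL.ne'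
  -- The centred frequency of index i in the batch. The sampling error is Σ H_i φ_i, with H_i known
  -- at time n and φ_i independent of the past with mean zero.
  set φ : Fin N → (Fin L → Fin N) → ℝ := fun i β =>
    (1 / (L : ℝ)) * ∑ j, (if β j = i then 1 else 0) - 1 / (N : ℝ) with hφ
  have hbm : Measurable (b n) := (hb.measurable n).mono (ℱ.le _) le_rfl
  have hφm : ∀ i, StronglyMeasurable[MeasurableSpace.comap (b n) inferInstance]
      (fun ω => φ i (b n ω)) := fun i =>
    ((Measurable.of_discrete (f := φ i)).comp (comap_measurable (b n))).stronglyMeasurable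
  have hφint : ∀ i, Integrable (fun ω => φ i (b n ω)) μ := fun i =>
    (Integrable.of_finite (f := φ i)).comp_measurable hbm
  have hmean : ∀ i, ∫ ω, φ i (b n ω) ∂μ = 0 := by
    intro i
    have hset : ∀ j, MeasurableSet {ω | b n ω j = i} := fun j =>
      (measurable_pi_apply j).comp hbm (measurableSet_singleton i)
    have hite : ∀ j, (fun ω => if b n ω j = i then (1 : ℝ) else 0) =
        {ω | b n ω j = i}.indicator 1 := fun j => by
      ext ω; simp [Set.indicator_apply]
    have hint : ∀ j, Integrable (fun ω => if b n ω j = i then (1 : ℝ) else 0) μ := fun j => by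
      rw [hite]; exact (integrable_const (1 : ℝ)).indicator (hset j)
    simp only [hφ]
    rw [integral_sub ((integrable_finsetSum _ fun j _ => hint j).const_mul _) (integrable_const _),
      integral_const_mul, integral_finsetSum _ fun j _ => hint j]
    have : ∀ j, ∫ ω, (if b n ω j = i then (1 : ℝ) else 0) ∂μ = μ.real {ω | b n ω j = i} :=
      fun j => by rw [hite, integral_indicator_one (hset j)]
    simp only [this, hb.uniform n i, integral_const, probReal_univ, smul_eq_mul]
    field_simp
    simp
  have hφ0 : ∀ i, μ[fun ω => φ i (b n ω) | ℱ n] =ᵐ[μ] 0 := fun i => by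
    have h1 := condExp_indep_eq hbm.comap_le (ℱ.le n) (hφm i) (hb.indep n)
    rw [hmean i] at h1
    exact h1
  have hprod : ∀ i, μ[H i * (fun ω => φ i (b n ω)) | ℱ n] =ᵐ[μ] 0 := fun i => by
    filter_upwards [condExp_stronglyMeasurable_mul_of_bound (ℱ.le n) (hH i) (hφint i) C
      (ae_of_all μ (hHC i)), hφ0 i] with ω h1 h2
    rw [h1, Pi.mul_apply, h2]
    simp
  have heq : (fun ω => (1 / (L : ℝ)) * ∑ j, H (b n ω j) ω - (1 / (N : ℝ)) * ∑ i, H i ω) =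
      ∑ i, H i * (fun ω => φ i (b n ω)) := by
    ext ω
    simp only [Finset.sum_apply, Pi.mul_apply, hφ, mul_sub, Finset.sum_sub_distrib]
    congr 1
    · have : ∀ j, H (b n ω j) ω = ∑ i, H i ω * (if b n ω j = i then 1 else 0) := fun j => by simp
      simp only [this]
      rw [Finset.sum_comm, Finset.mul_sum]
      refine Finset.sum_congr rfl fun i _ => ?_
      rw [← Finset.mul_sum]
      ring
    · rw [← Finset.sum_mul, mul_comm]
  rw [heq]
  refine (condExp_finsetSum (fun i _ => ?_) _).trans ?_
  · exact (hφint i).bdd_mul ((hH i).mono (ℱ.le n)).aestronglyMeasurable (ae_of_all _ (hHC i))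
  · filter_upwards [ae_all_iff.2 hprod] with ω hω
    rw [Finset.sum_apply]
    exact Finset.sum_eq_zero fun i _ => hω i

/-- Along almost every bounded path, the sampling noise accumulated against an adapted direction
with square-summable weights converges. -/
theorem ae_tendsto_sum_batch_noise {E : Type*} [NormedAddCommGroup E] [InnerProductSpace ℝ E]
    [FiniteDimensional ℝ E] [MeasurableSpace E] [BorelSpace E] {N L : ℕ} (hL : 0 < L)
    {b : ℕ → Ω → Fin L → Fin N} (hb : IsMiniBatchSampling μ ℱ b) {g : Fin N → E → E}
    (hg : ∀ i, Continuous (g i)) {w e : ℕ → Ω → E} (hw : ∀ n, Measurable[ℱ n] (w n))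
    (he : ∀ n, Measurable[ℱ n] (e n)) {a : ℕ → ℝ} (ha : Summable fun n => a n ^ 2) :
    ∀ᵐ ω ∂μ, (∃ R, ∀ n, ‖e n ω‖ ≤ R ∧ ‖w n ω‖ ≤ R) →
      ∃ l, Tendsto (fun n => ∑ k ∈ Finset.range n, a k * inner ℝ (e k ω)
        ((1 / (L : ℝ)) • ∑ j, g (b k ω j) (w k ω) - (1 / (N : ℝ)) • ∑ i, g i (w k ω)))
        atTop (𝓝 l) := by
  choose B hB0 hB using exists_norm_le_on_closedBall hg
  -- The bound on a path is random, so each term is truncated on an event known at time n. Integer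
  -- levels R suffice, and countably many almost sure statements can be intersected; on a path
  -- bounded by R the truncation has no effect.
  set A : ℕ → ℕ → Set Ω := fun R n => {ω | ‖e n ω‖ ≤ R ∧ ‖w n ω‖ ≤ R} with hA
  set H : ℕ → ℕ → Fin N → Ω → ℝ := fun R n i =>
    (A R n).indicator fun ω => a n * inner ℝ (e n ω) (g i (w n ω)) with hHdef
  have hAm : ∀ R n, MeasurableSet[ℱ n] (A R n) := fun R n =>
    (measurable_norm.comp (he n) measurableSet_Iic).inter
      (measurable_norm.comp (hw n) measurableSet_Iic)
  have hHm : ∀ R n i, StronglyMeasurable[ℱ n] (H R n i) := fun R n i =>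
    ((((he n).inner ((hg i).measurable.comp (hw n))).const_mul (a n)).indicator
      (hAm R n)).stronglyMeasurable
  have h0 : ∀ (R n : ℕ), 0 ≤ |a n| * (R * B R) := fun R n =>
    mul_nonneg (abs_nonneg _) (mul_nonneg R.cast_nonneg (hB0 R))
  have hHb : ∀ R n i ω, ‖H R n i ω‖ ≤ |a n| * (R * B R) := by
    intro R n i ω
    by_cases hω : ω ∈ A R n
    · rw [hHdef]
      simp only [Set.indicator_of_mem hω]
      rw [norm_mul, Real.norm_eq_abs]
      refine mul_le_mul_of_nonneg_left ((norm_inner_le_norm _ _).trans ?_) (abs_nonneg _)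
      exact mul_le_mul hω.1 (hB R i _ hω.2) (norm_nonneg _)
        (Nat.cast_nonneg _)
    · rw [hHdef]
      simp only [Set.indicator_of_notMem hω, norm_zero]
      exact h0 R n
  set X : ℕ → ℕ → Ω → ℝ := fun R n ω =>
    (1 / (L : ℝ)) * ∑ j, H R n (b n ω j) ω - (1 / (N : ℝ)) * ∑ i, H R n i ω with hX
  have hXm : ∀ R n, StronglyMeasurable[ℱ (n + 1)] (X R n) := by
    intro R n
    have h1 : ∀ i, Measurable[ℱ (n + 1)] (H R n i) := fun i =>
      ((hHm R n i).mono (ℱ.mono n.le_succ)).measurable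
    have h2 : ∀ j, Measurable[ℱ (n + 1)] fun ω => H R n (b n ω j) ω := by
      intro j
      have h3 : (fun ω => H R n (b n ω j) ω) =
          fun ω => ∑ i, {ω | b n ω j = i}.indicator (H R n i) ω := by
        ext ω
        simp [Set.indicator_apply]
      rw [h3]
      exact Finset.measurable_fun_sum _ fun i _ => (h1 i).indicator
        ((measurable_pi_apply j).comp (hb.measurable n) (measurableSet_singleton i))
    exact (((Finset.measurable_fun_sum _ fun j _ => h2 j).const_mul _).sub
      ((Finset.measurable_fun_sum _ fun i _ => h1 i).const_mul _)).stronglyMeasurable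
  have hXb : ∀ R n ω, |X R n ω| ≤ 2 * (R * B R) * |a n| := by
    intro R n ω
    have h1 := norm_average_le (h0 R n) (f := fun j => H R n (b n ω j) ω) fun j => hHb R n _ ω
    have h2 := norm_average_le (h0 R n) (f := fun i => H R n i ω) fun i => hHb R n i ω
    have h3 := abs_sub ((1 / (L : ℝ)) * ∑ j, H R n (b n ω j) ω) ((1 / (N : ℝ)) * ∑ i, H R n i ω)
    rw [smul_eq_mul, Real.norm_eq_abs] at h1 h2
    simp only [hX]
    linarith
  have hconv : ∀ᵐ ω ∂μ, ∀ R : ℕ, ∃ l,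
      Tendsto (fun n => ∑ k ∈ Finset.range n, X R k ω) atTop (𝓝 l) := by
    refine ae_all_iff.2 fun R => ae_tendsto_sum_of_martingale_difference (hXm R) (hXb R) ?_
      fun n => condExp_batch_average_sub hL hb n (hHm R n) (hHb R n)
    simp only [mul_pow, sq_abs]
    exact ha.mul_left _
  filter_upwards [hconv] with ω hω hR
  obtain ⟨R, hR⟩ := hR
  obtain ⟨R', hR'⟩ := exists_nat_ge R
  obtain ⟨l, hl⟩ := hω R'
  refine ⟨l, hl.congr fun n => Finset.sum_congr rfl fun k _ => ?_⟩
  have hmem : ω ∈ A R' k := ⟨(hR k).1.trans hR', (hR k).2.trans hR'⟩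
  simp only [hX, hHdef, Set.indicator_of_mem hmem]
  rw [inner_sub_right, real_inner_smul_right, real_inner_smul_right, inner_sum, inner_sum,
    ← Finset.mul_sum, ← Finset.mul_sum]
  ring

end Noise

/-! ### Gradients that are Lipschitz on balls. -/

section Smoothness

variable {E : Type*} [NormedAddCommGroup E] [InnerProductSpace ℝ E] [CompleteSpace E]

theorem continuous_gradient {φ : E → ℝ} (hφ : ContDiff ℝ 1 φ) : Continuous (gradient φ) :=
  (InnerProductSpace.toDual ℝ E).symm.continuous.comp (hφ.continuous_fderiv one_ne_zero)

/-- The mean value inequality for F minus its linearization on the segment. It yields K instead of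
the sharp K/2, which is immaterial here. -/
theorem le_add_inner_gradient_add_norm_sq {F : E → ℝ} {G : E → E} {s : Set E} (hs : Convex ℝ s)
    {K : ℝ} (hK : 0 ≤ K) (hF : ∀ w, HasGradientAt F (G w) w)
    (hG : ∀ w ∈ s, ∀ w' ∈ s, ‖G w - G w'‖ ≤ K * ‖w - w'‖) {w w' : E} (hw : w ∈ s) (hw' : w' ∈ s) :
    F w' ≤ F w + inner ℝ (G w) (w' - w) + K * ‖w' - w‖ ^ 2 := by
  have h := (convex_segment w w').norm_image_sub_le_of_norm_hasFDerivWithin_le'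
    (f := F) (f' := fun u => InnerProductSpace.toDual ℝ E (G u))
    (φ := InnerProductSpace.toDual ℝ E (G w)) (C := K * ‖w' - w‖)
    (fun u _ => (hF u).hasFDerivAt.hasFDerivWithinAt)
    (fun u hu => by
      rw [← map_sub, LinearIsometryEquiv.norm_map]
      refine (hG u (hs.segment_subset hw hw' hu) w hw).trans (mul_le_mul_of_nonneg_left ?_ hK)
      obtain ⟨t, ht, rfl⟩ := (segment_eq_image' ℝ w w').subset hu
      rw [add_sub_cancel_left, norm_smul, Real.norm_of_nonneg ht.1]
      exact mul_le_of_le_one_left (norm_nonneg _) ht.2)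
    (left_mem_segment ℝ w w') (right_mem_segment ℝ w w')
  rw [InnerProductSpace.toDual_apply_apply] at h
  have := (le_abs_self _).trans h
  linarith

theorem hasGradientAt_comp {φ : ℝ → ℝ} {ψ : E → ℝ} (hφ : ContDiff ℝ 1 φ) (hψ : ContDiff ℝ 1 ψ)
    (w : E) : HasGradientAt (fun w => φ (ψ w)) (deriv φ (ψ w) • gradient ψ w) w := by
  have h1 := ((hφ.differentiable one_ne_zero) (ψ w)).hasDerivAt
  have h2 := ((hψ.differentiable one_ne_zero) w).hasGradientAt.hasFDerivAt
  rw [hasGradientAt_iff_hasFDerivAt, map_smul]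
  exact h1.comp_hasFDerivAt w h2

/-- The composition of functions with Lipschitz gradients has a gradient which is Lipschitz on
balls. -/
theorem exists_lipschitz_gradient_comp [ProperSpace E] {φ : ℝ → ℝ} {ψ : E → ℝ}
    (hφ : ContDiff ℝ 1 φ) (hψ : ContDiff ℝ 1 ψ) {K₁ K₂ : ℝ≥0} (hφK : LipschitzWith K₁ (deriv φ))
    (hψK : LipschitzWith K₂ (gradient ψ)) (R : ℝ) :
    ∃ K : ℝ, 0 ≤ K ∧ ∀ w ∈ Metric.closedBall (0 : E) R, ∀ w' ∈ Metric.closedBall (0 : E) R,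
      ‖gradient (fun w => φ (ψ w)) w - gradient (fun w => φ (ψ w)) w'‖ ≤ K * ‖w - w'‖ := by
  have hcompact := isCompact_closedBall (0 : E) R
  obtain ⟨B, hB⟩ := hcompact.exists_bound_of_continuousOn (continuous_gradient hψ).continuousOn
  obtain ⟨B', hB'⟩ := hcompact.exists_bound_of_continuousOn
    ((hφ.continuous_deriv_one.comp hψ.continuous).continuousOn)
  refine ⟨|B'| * K₂ + K₁ * |B| * |B|, by positivity, fun w hw w' hw' => ?_⟩
  rw [(hasGradientAt_comp hφ hψ w).gradient, (hasGradientAt_comp hφ hψ w').gradient]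
  have hψlip : ‖ψ w - ψ w'‖ ≤ |B| * ‖w - w'‖ :=
    (convex_closedBall (0 : E) R).norm_image_sub_le_of_norm_hasFDerivWithin_le
      (f' := fun u => InnerProductSpace.toDual ℝ E (gradient ψ u))
      (fun u _ => ((hψ.differentiable one_ne_zero) u).hasGradientAt.hasFDerivAt.hasFDerivWithinAt)
      (fun u hu => by
        rw [LinearIsometryEquiv.norm_map]
        exact (hB u hu).trans (le_abs_self _)) hw' hw
  have h1 : ‖deriv φ (ψ w)‖ ≤ |B'| := (hB' w hw).trans (le_abs_self _)
  have h2 : ‖gradient ψ w - gradient ψ w'‖ ≤ K₂ * ‖w - w'‖ := hψK.norm_sub_le w w'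
  have h3 : ‖deriv φ (ψ w) - deriv φ (ψ w')‖ ≤ K₁ * (|B| * ‖w - w'‖) :=
    (hφK.norm_sub_le _ _).trans (mul_le_mul_of_nonneg_left hψlip K₁.2)
  have h4 : ‖gradient ψ w'‖ ≤ |B| := (hB w' hw').trans (le_abs_self _)
  calc ‖deriv φ (ψ w) • gradient ψ w - deriv φ (ψ w') • gradient ψ w'‖
      = ‖deriv φ (ψ w) • (gradient ψ w - gradient ψ w')
          + (deriv φ (ψ w) - deriv φ (ψ w')) • gradient ψ w'‖ := by congr 1; module
    _ ≤ ‖deriv φ (ψ w)‖ * ‖gradient ψ w - gradient ψ w'‖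
          + ‖deriv φ (ψ w) - deriv φ (ψ w')‖ * ‖gradient ψ w'‖ :=
        (norm_add_le _ _).trans_eq (by rw [norm_smul, norm_smul])
    _ ≤ |B'| * (K₂ * ‖w - w'‖) + K₁ * (|B| * ‖w - w'‖) * |B| := by gcongr
    _ = _ := by ring

end Smoothness

/-! ### The training loss and the surrogate problem. -/

section Problem

variable {Q p N L : ℕ}

theorem contDiff_sampleLoss {f : Weights Q → EuclideanSpace ℝ (Fin p) → ℝ}
    (hf : NetworkAssumption f) {l : ℝ → ℝ → ℝ} (hl : LossAssumption l)
    (x : Fin N → EuclideanSpace ℝ (Fin p)) (y : Fin N → ℝ) (i : Fin N) :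
    ContDiff ℝ 1 (sampleLoss l f x y i) :=
  (hl.contDiff (y i)).comp (hf.contDiff (x i))

/-- The chain rule multiplies two Lipschitz factors that may be unbounded, so the Lipschitz property
is only local; bounded iterates make this enough. -/
theorem exists_lipschitz_gradient_sampleLoss {f : Weights Q → EuclideanSpace ℝ (Fin p) → ℝ}
    (hf : NetworkAssumption f) {l : ℝ → ℝ → ℝ} (hl : LossAssumption l)
    (x : Fin N → EuclideanSpace ℝ (Fin p)) (y : Fin N → ℝ) (R : ℝ) :
    ∃ K : ℝ, 0 ≤ K ∧ ∀ i, ∀ w ∈ Metric.closedBall (0 : Weights Q) R,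
      ∀ w' ∈ Metric.closedBall (0 : Weights Q) R,
      ‖gradient (sampleLoss l f x y i) w - gradient (sampleLoss l f x y i) w'‖ ≤ K * ‖w - w'‖ := by
  have h : ∀ i : Fin N, ∃ K : ℝ, 0 ≤ K ∧ ∀ w ∈ Metric.closedBall (0 : Weights Q) R,
      ∀ w' ∈ Metric.closedBall (0 : Weights Q) R,
      ‖gradient (sampleLoss l f x y i) w - gradient (sampleLoss l f x y i) w'‖ ≤ K * ‖w - w'‖ := by
    intro i
    obtain ⟨K₁, hK₁⟩ := hl.lipschitz_deriv (y i)
    obtain ⟨K₂, hK₂⟩ := hf.lipschitz_gradient (x i)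
    exact exists_lipschitz_gradient_comp (hl.contDiff (y i)) (hf.contDiff (x i)) hK₁ hK₂ R
  choose K hK0 hK using h
  refine ⟨∑ i, K i, Finset.sum_nonneg fun i _ => hK0 i, fun i w hw w' hw' => ?_⟩
  exact (hK i w hw w' hw').trans (mul_le_mul_of_nonneg_right
    (Finset.single_le_sum (fun i _ => hK0 i) (Finset.mem_univ i)) (norm_nonneg _))

theorem hasGradientAt_empiricalLoss {li : Fin N → Weights Q → ℝ} (hli : ∀ i, ContDiff ℝ 1 (li i))
    (w : Weights Q) :
    HasGradientAt (empiricalLoss li) ((1 / (N : ℝ)) • ∑ i, gradient (li i) w) w := by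
  rw [hasGradientAt_iff_hasFDerivAt, map_smul, map_sum]
  exact (HasFDerivAt.fun_sum fun i _ =>
    (((hli i).differentiable one_ne_zero) w).hasGradientAt.hasFDerivAt).const_mul _

/-- Optimality condition of the surrogate problem. -/
theorem surrogateObjective_subgradient {lt : Fin N → Weights Q → Weights Q → ℝ}
    {r : Weights Q → ℝ} {lam τ ρ m : ℝ} {b : Fin L → Fin N} {z d v : Weights Q}
    (hlt : ∀ i z, Differentiable ℝ (fun u => lt i u z)) (hlam : 0 ≤ lam)
    (hr : StrongConvexOn Set.univ m r)
    (hv : IsMinOn (surrogateObjective lt r lam τ ρ b z d) Set.univ v) (u : Weights Q) :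
    lam * r v - inner ℝ (ρ • ((1 / (L : ℝ)) • ∑ j, gradient (fun u => lt (b j) u z) v) +
      (1 - ρ) • d + (2 * τ) • (v - z)) (u - v) + lam * (m / 2 * ‖u - v‖ ^ 2) ≤ lam * r u := by
  refine strong_subgradient_of_isMin (ψ := fun u => ρ * ((1 / (L : ℝ)) * ∑ j, lt (b j) u z) +
    (1 - ρ) * inner ℝ d (u - z) + τ * ‖u - z‖ ^ 2) ?_ hr hlam (fun u => ?_) u
  · rw [hasGradientAt_iff_hasFDerivAt]
    have hsub : HasFDerivAt (fun u : Weights Q => u - z) (ContinuousLinearMap.id ℝ _) v :=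
      (hasFDerivAt_id v).sub_const z
    have h1 := ((HasFDerivAt.fun_sum fun j (_ : j ∈ Finset.univ) =>
      ((hlt (b j) z) v).hasGradientAt.hasFDerivAt).const_mul (1 / (L : ℝ))).const_mul ρ
    have h2 := (((innerSL ℝ d).hasFDerivAt).comp v hsub).const_mul (1 - ρ)
    have h3 := hsub.norm_sq.const_mul τ
    refine ((h1.add h2).add h3).congr_fderiv ?_
    ext q
    simp
    ring
  · have := hv (Set.mem_univ u)
    simp only [Set.mem_ofPred_eq, surrogateObjective] at this
    linarith

end Problem

/-! ### From a single path to stationarity. -/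

section Run

variable {Q N L : ℕ}

/-- Along a bounded path on which the accumulated sampling noise converges, every cluster point of
the iterates is stationary. -/
theorem isStationaryPoint_of_mapClusterPt {li : Fin N → Weights Q → ℝ}
    {lt : Fin N → Weights Q → Weights Q → ℝ} {r : Weights Q → ℝ} {lam τ m R : ℝ} {α ρ : ℕ → ℝ}
    {b : ℕ → Fin L → Fin N} {w v d : ℕ → Weights Q}
    (hli : ∀ i, ContDiff ℝ 1 (li i))
    (hlip : ∀ R : ℝ, ∃ K : ℝ, 0 ≤ K ∧ ∀ i, ∀ w ∈ Metric.closedBall (0 : Weights Q) R,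
      ∀ w' ∈ Metric.closedBall (0 : Weights Q) R,
      ‖gradient (li i) w - gradient (li i) w'‖ ≤ K * ‖w - w'‖)
    (hlt : SurrogateAssumption li lt)
    (hlam : 0 < lam) (hm : 0 ≤ m) (hτ : 0 ≤ τ) (hc : 0 < 2 * τ + lam * m)
    (hr : StrongConvexOn Set.univ m r)
    (hα : IsDiminishing α) (hρ : IsDiminishing ρ) (hρ_pos : ∀ n, 0 < ρ n)
    (hαρ : Tendsto (fun n => α n / ρ n) atTop (𝓝 0)) (hR : ∀ n, ‖w n‖ ≤ R)
    (hv : ∀ n, IsMinOn (surrogateObjective lt r lam τ (ρ n) (b n) (w n) (d n)) Set.univ (v n))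
    (hw : ∀ n, w (n + 1) = (1 - α n) • w n + α n • v n)
    (hd : ∀ n, d (n + 1) = (1 - ρ n) • d n +
      ρ n • ((1 / (L : ℝ)) • ∑ j, gradient (li (b n j)) (w n)))
    (hnoise : (∃ R, ∀ n, ‖d n - (1 / (N : ℝ)) • ∑ i, gradient (li i) (w n)‖ ≤ R ∧ ‖w n‖ ≤ R) →
      ∃ l, Tendsto (fun n => ∑ k ∈ Finset.range n, 2 * (1 - ρ k) * ρ k *
        inner ℝ (d k - (1 / (N : ℝ)) • ∑ i, gradient (li i) (w k))
        ((1 / (L : ℝ)) • ∑ j, gradient (li (b k j)) (w k)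
          - (1 / (N : ℝ)) • ∑ i, gradient (li i) (w k))) atTop (𝓝 l))
    {wbar : Weights Q} (hwbar : MapClusterPt wbar atTop w) :
    IsStationaryPoint li r lam wbar := by
  have hrc : ConvexOn ℝ Set.univ r :=
    strongConvexOn_zero.1 (hr.mono hm)
  have hrcont : Continuous r := continuousOn_univ.1 (hrc.continuousOn isOpen_univ)
  have hgcont : ∀ i, Continuous (gradient (li i)) := fun i => continuous_gradient (hli i)
  set G : Weights Q → Weights Q := fun w => (1 / (N : ℝ)) • ∑ i, gradient (li i) w with hG_def
  have hGcont : Continuous G := by fun_prop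
  have hgrad : ∀ w, HasGradientAt (empiricalLoss li) (G w) w := hasGradientAt_empiricalLoss hli
  have hmem : ∀ n, w n ∈ Metric.closedBall (0 : Weights Q) R := fun n => by simpa using hR n
  obtain ⟨B, hB0, hB⟩ := exists_norm_le_on_closedBall hgcont R
  obtain ⟨K, hK0, hK⟩ := hlip R
  obtain ⟨M, hM⟩ := hlt.lipschitz_gradient R
  obtain ⟨P, hP⟩ := hρ.tendsto_zero.bddAbove_range
  have hP : ∀ n, ρ n ≤ P := fun n => hP ⟨n, rfl⟩
  have hGB : ∀ n, ‖G (w n)‖ ≤ B := fun n => norm_average_le hB0 fun i => hB i _ (hR n)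
  have hsB : ∀ n, ‖(1 / (L : ℝ)) • ∑ j, gradient (li (b n j)) (w n)‖ ≤ B := fun n =>
    norm_average_le hB0 fun j => hB _ _ (hR n)
  obtain ⟨D, hD⟩ := exists_norm_le_of_averaging hρ.nonneg
    ((hρ.tendsto_zero.eventually_lt_const zero_lt_one).mono fun _ h => h.le) hsB hd
  have hR0 : 0 ≤ R := (norm_nonneg _).trans (hR 0)
  have hD0 : 0 ≤ D := (norm_nonneg _).trans (hD 0)
  set q : ℕ → Weights Q → Weights Q := fun n u =>
    (1 / (L : ℝ)) • ∑ j, gradient (fun u => lt (b n j) u (w n)) u with hq_def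
  -- Linear growth: at the base point the surrogate gradient is a true gradient, bounded on the
  -- ball, and the Lipschitz constant is common to all base points there.
  have hqB : ∀ n u, ‖q n u‖ ≤ B + M * (‖u‖ + R) := by
    intro n u
    refine norm_average_le (by positivity) fun j => ?_
    have h1 := (hM (b n j) (w n) (hR n)).norm_sub_le u (w n)
    rw [hlt.gradient_eq] at h1
    have h2 := norm_le_norm_add_norm_sub (gradient (li (b n j)) (w n))
      (gradient (fun u => lt (b n j) u (w n)) u)
    rw [norm_sub_rev] at h2
    have h3 : M * ‖u - w n‖ ≤ M * (‖u‖ + R) :=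
      mul_le_mul_of_nonneg_left ((norm_sub_le _ _).trans (add_le_add le_rfl (hR n))) M.2
    linarith [hB (b n j) (w n) (hR n)]
  have hqmono : ∀ n u u', 0 ≤ inner ℝ (q n u' - q n u) (u' - u) := by
    intro n u u'
    simp only [hq_def, ← smul_sub, ← Finset.sum_sub_distrib]
    rw [real_inner_smul_left, sum_inner]
    refine mul_nonneg (by positivity) (Finset.sum_nonneg fun j _ => ?_)
    exact inner_gradient_sub_nonneg (hlt.convex (b n j) (w n))
      (hlt.differentiable (b n j) (w n) u).hasGradientAt
      (hlt.differentiable (b n j) (w n) u').hasGradientAt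
  set h : ℕ → Weights Q := fun n => ρ n • q n (v n) + (1 - ρ n) • d n with hh_def
  have hopt : ∀ n u, lam * r (v n) - inner ℝ (h n + (2 * τ) • (v n - w n)) (u - v n) +
      lam * (m / 2 * ‖u - v n‖ ^ 2) ≤ lam * r u := fun n u =>
    surrogateObjective_subgradient hlt.differentiable hlam.le hr (hv n) u
  -- Boundedness of v is not assumed. Compare v n with v 0, freezing the surrogate gradient at v 0:
  -- the remainder is monotone and drops out, so the bound involves no unknown value of v n.
  obtain ⟨V, hV⟩ : ∃ V, ∀ n, ‖v n‖ ≤ V := by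
    set S := P * (B + M * (‖v 0‖ + R)) + (1 + P) * D with hS
    have hP0 : 0 ≤ P := (hρ.nonneg 0).trans (hP 0)
    refine ⟨‖v 0‖ + (S + ‖h 0‖ + 2 * τ * (R + R)) / (2 * τ + lam * m), fun n => ?_⟩
    have h1 := norm_sub_le_of_strong_subgradient (p := ρ n • (q n (v n) - q n (v 0)))
      (h' := ρ n • q n (v 0) + (1 - ρ n) • d n) (v' := v n) hτ (hopt 0)
      (fun u => by
        have h2 := hopt n u
        have h3 : ρ n • q n (v 0) + (1 - ρ n) • d n + ρ n • (q n (v n) - q n (v 0)) = h n := by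
          simp only [hh_def]; module
        rwa [h3])
      (by
        rw [real_inner_smul_left]
        exact mul_nonneg (hρ.nonneg n) (hqmono n _ _))
    have h4 : ‖ρ n • q n (v 0) + (1 - ρ n) • d n‖ ≤ S := by
      refine (norm_add_le _ _).trans (add_le_add ?_ ?_)
      · rw [norm_smul, Real.norm_of_nonneg (hρ.nonneg n)]
        exact mul_le_mul (hP n) (hqB n _) (norm_nonneg _) hP0
      · rw [norm_smul]
        refine mul_le_mul ((norm_sub_le _ _).trans ?_) (hD n) (norm_nonneg _) (by linarith)
        rw [norm_one, Real.norm_of_nonneg (hρ.nonneg n)]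
        linarith [hP n]
    have h5 := norm_sub_le (ρ n • q n (v 0) + (1 - ρ n) • d n) (h 0)
    have h6 : 2 * τ * ‖w n - w 0‖ ≤ 2 * τ * (R + R) :=
      mul_le_mul_of_nonneg_left ((norm_sub_le _ _).trans (add_le_add (hR n) (hR 0))) (by linarith)
    have h7 : ‖v n - v 0‖ ≤ (S + ‖h 0‖ + 2 * τ * (R + R)) / (2 * τ + lam * m) := by
      rw [le_div_iff₀ hc]
      linarith
    linarith [norm_le_norm_add_norm_sub (v 0) (v n), norm_sub_rev (v 0) (v n)]
  -- The surrogates enter with weight ρ, so asymptotically only d drives the step.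
  have hhd : ∀ n, ‖h n - d n‖ ≤ (B + M * (V + R) + D) * ρ n := by
    intro n
    have h1 : h n - d n = ρ n • (q n (v n) - d n) := by simp only [hh_def]; module
    rw [h1, norm_smul, Real.norm_of_nonneg (hρ.nonneg n), mul_comm]
    refine mul_le_mul_of_nonneg_right ((norm_sub_le _ _).trans (add_le_add ?_ (hD n))) (hρ.nonneg n)
    refine (hqB n (v n)).trans ?_
    have := mul_le_mul_of_nonneg_left (add_le_add (hV n) (le_refl R)) M.2
    change (M : ℝ) * (‖v n‖ + R) ≤ M * (V + R) at this
    linarith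
  have hGlip : ∀ u ∈ Metric.closedBall (0 : Weights Q) R,
      ∀ u' ∈ Metric.closedBall (0 : Weights Q) R, ‖G u - G u'‖ ≤ K * ‖u - u'‖ := by
    intro u hu u' hu'
    simp only [hG_def, ← smul_sub, ← Finset.sum_sub_distrib]
    exact norm_average_le (by positivity) fun i => hK i u hu u' hu'
  have hFcont : Continuous (empiricalLoss li) :=
    continuous_iff_continuousAt.2 fun u => (hgrad u).continuousAt
  obtain ⟨U, hU⟩ := (isCompact_closedBall (0 : Weights Q) R).bddBelow_image
    (f := fun u => empiricalLoss li u + lam * r u) (by fun_prop)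
  obtain ⟨l, hl⟩ := hnoise ⟨max (D + B) R, fun n =>
    ⟨((norm_sub_le _ _).trans (add_le_add (hD n) (hGB n))).trans (le_max_left _ _),
      (hR n).trans (le_max_right _ _)⟩⟩
  obtain ⟨he, hΔ⟩ := tendsto_zero_of_noise_converges (F := empiricalLoss li) (G := G) (R := V + R)
    (B := B + B) hlam.le hm hτ hc hrc hα hρ hρ_pos hαρ
    (fun n => (norm_sub_le _ _).trans (add_le_add (hV n) (hR n)))
    (fun n => (norm_sub_le _ _).trans (add_le_add (hsB n) (hGB n))) hw hd hK0
    (fun i j => hGlip _ (hmem i) _ (hmem j))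
    (fun n => le_add_inner_gradient_add_norm_sq (convex_closedBall 0 R) hK0 hgrad hGlip (hmem n)
      (hmem (n + 1)))
    (fun n => hU ⟨w n, hmem n, rfl⟩) hhd hopt hl
  obtain ⟨φ, hφ, hwφ⟩ := hwbar.tendsto_subseq
  have hvφ : Tendsto (fun k => v (φ k)) atTop (𝓝 wbar) := by
    simpa using (hΔ.comp hφ.tendsto_atTop).add hwφ
  have hhd0 : Tendsto (fun n => h n - d n) atTop (𝓝 0) := by
    refine squeeze_zero_norm hhd ?_
    simpa using hρ.tendsto_zero.const_mul (B + M * (V + R) + D)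
  have hhφ : Tendsto (fun k => h (φ k)) atTop (𝓝 (G wbar)) := by
    have h1 := ((hhd0.add he).comp hφ.tendsto_atTop).add ((hGcont.tendsto wbar).comp hwφ)
    simp only [add_zero, zero_add] at h1
    refine h1.congr fun k => ?_
    simp only [Function.comp_apply]
    abel
  refine ⟨-(lam⁻¹ • G wbar), fun u => ?_, ?_⟩
  · have hlim : Tendsto (fun k => lam * r (v (φ k)) -
        inner ℝ (h (φ k) + (2 * τ) • (v (φ k) - w (φ k))) (u - v (φ k))) atTop
        (𝓝 (lam * r wbar - inner ℝ (G wbar + (2 * τ) • (0 : Weights Q)) (u - wbar))) :=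
      (((hrcont.tendsto wbar).comp hvφ).const_mul lam).sub
        ((hhφ.add ((hΔ.comp hφ.tendsto_atTop).const_smul (2 * τ))).inner
          (tendsto_const_nhds.sub hvφ))
    have hle := le_of_tendsto' hlim (b := lam * r u) fun k => by
      have h1 := hopt (φ k) u
      have h2 : 0 ≤ lam * (m / 2 * ‖u - v (φ k)‖ ^ 2) := by positivity
      linarith
    rw [smul_zero, add_zero] at hle
    rw [inner_neg_left, real_inner_smul_left]
    refine le_of_mul_le_mul_left ?_ hlam
    rw [mul_add, mul_neg, mul_inv_cancel_left₀ hlam.ne']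
    linarith
  · rw [(hgrad wbar).gradient, smul_neg, smul_inv_smul₀ hlam.ne', add_neg_cancel]

/-- Adaptedness of d follows from its recursion. The random index is handled by joint measurability
over a countable index set. -/
theorem IsSCARun.measurable_d {Ω : Type*} {mΩ : MeasurableSpace Ω} {μ : Measure Ω}
    {ℱ : Filtration ℕ mΩ} {li : Fin N → Weights Q → ℝ}
    {lt : Fin N → Weights Q → Weights Q → ℝ} {r : Weights Q → ℝ} {lam τ : ℝ} {α ρ : ℕ → ℝ}
    {b : ℕ → Ω → Fin L → Fin N} {w what d : ℕ → Ω → Weights Q}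
    (hrun : IsSCARun ℱ li lt r lam τ α ρ b w what d) (hb : IsMiniBatchSampling μ ℱ b)
    (hg : ∀ i, Continuous (gradient (li i))) (n : ℕ) : Measurable[ℱ n] (d n) := by
  induction n with
  | zero => exact hrun.measurable_d_zero
  | succ n ih =>
    have hd : d (n + 1) = fun ω => (1 - ρ n) • d n ω +
        ρ n • ((1 / (L : ℝ)) • ∑ j, gradient (li (b n ω j)) (w n ω)) := funext (hrun.d_succ n)
    have hterm : ∀ j, Measurable[ℱ (n + 1)] fun ω => gradient (li (b n ω j)) (w n ω) := by
      intro j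
      have h1 : Measurable fun x : Weights Q × Fin N => gradient (li x.2) x.1 :=
        measurable_from_prod_countable_left fun i => (hg i).measurable
      exact h1.comp (((hrun.measurable_w n).mono (ℱ.mono n.le_succ) le_rfl).prodMk
        ((measurable_pi_apply j).comp (hb.measurable n)))
    rw [hd]
    exact ((ih.mono (ℱ.mono n.le_succ) le_rfl).const_smul (1 - ρ n)).add
      (((Finset.measurable_fun_sum _ fun j _ => hterm j).const_smul (1 / (L : ℝ))).const_smul (ρ n))

theorem IsDiminishing.summable_noise_weights {ρ : ℕ → ℝ} (hρ : IsDiminishing ρ) :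
    Summable fun n => (2 * (1 - ρ n) * ρ n) ^ 2 := by
  refine Summable.of_norm_bounded_eventually_nat (hρ.summable_sq.mul_left 4) ?_
  filter_upwards [hρ.tendsto_zero.eventually_lt_const zero_lt_one] with n hn
  have h0 := hρ.nonneg n
  rw [Real.norm_of_nonneg (sq_nonneg _), mul_pow, mul_pow]
  have h1 : (1 - ρ n) ^ 2 ≤ 1 := pow_le_one₀ (by linarith) (by linarith)
  have h2 := mul_le_mul_of_nonneg_right h1 (sq_nonneg (ρ n))
  linarith

end Run

end StochasticSCA

theorem proposition1
    {Ω : Type*} {mΩ : MeasurableSpace Ω} (μ : Measure Ω) [IsProbabilityMeasure μ]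
    (ℱ : Filtration ℕ mΩ) {Q p N L : ℕ} (hL : 0 < L)
    -- network, loss, training set, regularizer
    (f : StochasticSCA.Weights Q → EuclideanSpace ℝ (Fin p) → ℝ)
    (hf : StochasticSCA.NetworkAssumption f)
    (l : ℝ → ℝ → ℝ) (hl : StochasticSCA.LossAssumption l)
    (x : Fin N → EuclideanSpace ℝ (Fin p)) (y : Fin N → ℝ)
    (r : StochasticSCA.Weights Q → ℝ) (hr : ConvexOn ℝ Set.univ r)
    (lam : ℝ) (hlam : 0 < lam)
    -- surrogates
    (lt : Fin N → StochasticSCA.Weights Q → StochasticSCA.Weights Q → ℝ)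
    (hlt : StochasticSCA.SurrogateAssumption (StochasticSCA.sampleLoss l f x y) lt)
    -- proximal weight: positive, or zero if the regularizer is strongly convex
    (τ : ℝ) (hτ : 0 < τ ∨ (τ = 0 ∧ ∃ m : ℝ, 0 < m ∧ StrongConvexOn Set.univ m r))
    -- step sizes and mixing weights
    (α ρ : ℕ → ℝ) (hα : StochasticSCA.IsDiminishing α) (hρ : StochasticSCA.IsDiminishing ρ)
    (hρ_pos : ∀ n, 0 < ρ n) (hαρ : Tendsto (fun n => α n / ρ n) atTop (𝓝 0))
    -- mini-batches and the iterates of the algorithm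
    (b : ℕ → Ω → Fin L → Fin N) (hb : StochasticSCA.IsMiniBatchSampling μ ℱ b)
    (w what d : ℕ → Ω → StochasticSCA.Weights Q)
    (hrun : StochasticSCA.IsSCARun ℱ (StochasticSCA.sampleLoss l f x y) lt r lam τ α ρ b w what d)
    (hbdd : ∀ᵐ ω ∂μ, Bornology.IsBounded (Set.range (fun n => w n ω))) :
    ∀ᵐ ω ∂μ,
      (∃ wbar, MapClusterPt wbar atTop (fun n => w n ω)) ∧
      ∀ wbar, MapClusterPt wbar atTop (fun n => w n ω) →
        StochasticSCA.IsStationaryPoint (StochasticSCA.sampleLoss l f x y) r lam wbar ∧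
        ∃ φ : ℕ → ℕ, StrictMono φ ∧ Tendsto (fun k => w (φ k) ω) atTop (𝓝 wbar) := by
  -- Both alternatives for τ reduce to a positive modulus 2τ + λm, with m = 0 when τ is positive.
  obtain ⟨m, hm, hτ0, hc, hrm⟩ : ∃ m : ℝ, 0 ≤ m ∧ 0 ≤ τ ∧ 0 < 2 * τ + lam * m ∧
      StrongConvexOn Set.univ m r := by
    rcases hτ with hτ | ⟨rfl, m, hm, hrm⟩
    · exact ⟨0, le_rfl, hτ.le, by linarith, strongConvexOn_zero.2 hr⟩
    · exact ⟨m, hm.le, le_rfl, by linarith [mul_pos hlam hm], hrm⟩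
  have hli := StochasticSCA.contDiff_sampleLoss hf hl x y
  have hg := fun i => StochasticSCA.continuous_gradient (hli i)
  have hGw : ∀ n, Measurable[ℱ n] fun ω =>
      (1 / (N : ℝ)) • ∑ i, gradient (StochasticSCA.sampleLoss l f x y i) (w n ω) := fun n =>
    (Finset.measurable_fun_sum Finset.univ fun i _ =>
      (hg i).measurable.comp (hrun.measurable_w n)).const_smul (1 / (N : ℝ))
  filter_upwards [hbdd, StochasticSCA.ae_tendsto_sum_batch_noise hL hb hg hrun.measurable_w
    (fun n => (hrun.measurable_d hb hg n).sub (hGw n)) hρ.summable_noise_weights] with ω hω hnoise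
  obtain ⟨R, hR⟩ := hω.exists_norm_le
  refine ⟨?_, fun wbar hwbar => ⟨?_, hwbar.tendsto_subseq⟩⟩
  · obtain ⟨wbar, -, φ, hφ, hlim⟩ := tendsto_subseq_of_bounded hω fun n => ⟨n, rfl⟩
    exact ⟨wbar, hlim.mapClusterPt.of_comp hφ.tendsto_atTop⟩
  · exact StochasticSCA.isStationaryPoint_of_mapClusterPt hli
      (StochasticSCA.exists_lipschitz_gradient_sampleLoss hf hl x y) hlt hlam hm hτ0 hc hrm hα hρ
      hρ_pos hαρ (fun n => hR _ ⟨n, rfl⟩) (fun n => hrun.what_succ n ω) (fun n => hrun.w_succ n ω)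
      (fun n => hrun.d_succ n ω) hnoise hwbar
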